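/- Let $n\in\{1,2,\dots,\infty\}$ and let $\mathcal{TO}_n$ be the universal unital $C^*$-algebra generated by isometries $v_1,\dots,v_n$ (countably many $v_i$ if $n=\infty$) with mutually orthogonal ranges. For a multi-index $\mu=(i_1,\dots,i_k)$ put $v_\mu=v_{i_1}\cdots v_{i_k}$. Let $\gamma$ be the gauge action of the circle $\mathbb T$, $\gamma_\lambda(v_i)=\lambda v_i$, and let $\mathcal F_n$ be its fixed-point algebra. Let $\mathcal E$ be the closed linear span of the $v_i$, a Hilbert space with orthonormal basis $(v_i)$ and inner product linear in the first variable; for $f,g\in\mathcal E$ let $f\otimes\overline g$ denote the operator $h\mapsto\langle h,g\rangle f$. A state $\rho$ of $\mathcal F_n$ is a *product state* if there are states $\rho_1,\rho_2,\dots$ of the compact operators $\mathcal K(\mathcal E)$ with $\rho(v_{i_1}\cdots v_{i_m}v_{j_m}^*\cdots v_{j_1}^*)=\prod_{k=1}^m\rho_k(v_{i_k}\otimes\overline{v_{j_k}})$ for all $m$ and all indices. It is *essential* if in its GNS representation $\pi$ one has $\sum_{|\mu|=k}\pi(v_\mu v_\mu^*)=I$ (strongly) for every $k$. A pure product state has *finite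 period* $p$ if it arises in this way from the vector states $\rho_k$ of unit vectors $e_k\in\mathcal E$ such that $p$ is the smallest positive integer for which $\sum_{i=1}^\infty(1-|\langle e_i,e_{i+p}\rangle|)<\infty$. Suppose that $\rho$ is a pure essential product state of $\mathcal F_n$ with finite period $p$. Then: 1. The gauge group acts $p$-to-$1$ transitively on the extensions of $\rho$ to pure states of $\mathcal{TO}_n$: if $\tau$ is such an extension then so is $\tau\circ\gamma_\lambda$ for every $\lambda\in\mathbb T$, and for any two such extensions $\tau,\tau'$ there are exactly $p$ elements $\lambda\in\mathbb T$ with $\tau\circ\gamma_\lambda=\tau'$. 2. The unit vectors $e_k$ whose vector states give $\rho$ can be chosen (by changing their phases) so that $\langle e_i,e_{i+p}\rangle\ge 0$ for all $i$. For every such choice and every Borel probability measure $\sigma$ on $\mathbb T$ there is exactly one continuous linear functional $\rho_\sigma$ on $\mathcal{TO}_n$ with $$\rho_\sigma(v_{i_1}\cdots v_{i_k}v_{j_l}^*\cdots v_{j_1}^*)=\lambda_{k,l}\,\langle v_{i_1},e_1\rangle\cdots\langle v_{i_k},e_k\rangle\,\langle e_l,v_{j_l}\rangle\cdots\langle e_1,v_{j_1}\rangle$$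 for all $k,l\ge 0$ and all indices, where $\lambda_{k,l}=\hat\sigma\big(\tfrac{k-l}{p}\big)\prod_{i=1}^\infty\langle e_{l+i},e_{k+i}\rangle$ if $p$ divides $k-l$ (the product being the limit of its partial products, which exists), $\lambda_{k,l}=0$ otherwise, and $\hat\sigma(a)=\int_{\mathbb T}z^{-a}\,d\sigma(z)$. The functional $\rho_\sigma$ is a state extending $\rho$, and it is pure if and only if $\sigma$ is a point measure $\delta_z$, $z\in\mathbb T$. 3. The pure extensions form precisely a circle: $z\mapsto\rho_{\delta_z}$ is a homeomorphism of $\mathbb T$ onto the set of all extensions of $\rho$ to pure states of $\mathcal{TO}_n$, with the weak-* topology. -/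

import Mathlib

open scoped ENNReal InnerProductSpace ComplexOrder
open Filter Topology MeasureTheory

noncomputable section

namespace ToeplitzCuntz

/-! ### The Toeplitz-Cuntz algebra -/

/-- A family of isometries `w i` with mutually orthogonal ranges, in a unital star ring. -/
def IsToeplitzCuntzFamily {ι : Type*} {B : Type*} [Ring B] [StarRing B] (w : ι → B) : Prop :=
  (∀ i, star (w i) * w i = 1) ∧ ∀ i j, i ≠ j → star (w i) * w j = 0

/-- The type of all families of isometries with mutually orthogonal ranges, indexed by `ι`, in
nonzero unital C*-algebras. -/
structure Family (ι : Type) : Type 1 where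
  B : Type
  [cstar : CStarAlgebra B]
  [nontriv : Nontrivial B]
  w : ι → B
  isFamily : IsToeplitzCuntzFamily w

attribute [instance] Family.cstar Family.nontriv

instance lpInftyCStarAlgebra {I : Type*} {A : I → Type*} [∀ i, Nontrivial (A i)]
    [∀ i, CStarAlgebra (A i)] : CStarAlgebra (lp A ∞) where

/-- The C*-algebra of bounded elements of the product, over all families, of the target algebras
(with coordinatewise operations and the supremum norm). -/
abbrev Ambient (ι : Type) : Type 1 := lp (fun j : Family ι => j.B) ∞

variable {ι : Type}

lemma norm_le_one_of_isometry {B : Type*} [CStarAlgebra B] [Nontrivial B] {b : B}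
    (h : star b * b = 1) : ‖b‖ ≤ 1 := by
  have h1 : ‖b‖ * ‖b‖ = 1 := by rw [← CStarRing.norm_star_mul_self, h, norm_one]
  nlinarith [norm_nonneg b]

/-- The family in the product algebra whose coordinate at each family `w` is `w` itself. -/
def ambientGen (i : ι) : Ambient ι :=
  ⟨fun j => j.w i, memℓp_infty ⟨1, by
    rintro _ ⟨j, rfl⟩
    exact norm_le_one_of_isometry (j.isFamily.1 i)⟩⟩

/-- The Toeplitz-Cuntz algebra as the closed unital star subalgebra generated by the tuple of all
families; see `TO.lift` for its universal property. -/
def toSubalgebra (ι : Type) : StarSubalgebra ℂ (Ambient ι) :=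
  (StarAlgebra.adjoin ℂ (Set.range (ambientGen (ι := ι)))).topologicalClosure

instance : IsClosed (toSubalgebra ι : Set (Ambient ι)) :=
  StarSubalgebra.isClosed_topologicalClosure _

/-- The Toeplitz-Cuntz algebra `𝒯𝒪_n`, where `n` is the cardinality of `ι`: the unital C*-algebra
which is universal for families, indexed by `ι`, of isometries with mutually orthogonal ranges. -/
abbrev TO (ι : Type) : Type 1 := toSubalgebra ι

/-- The distinguished generating isometries of the Toeplitz-Cuntz algebra. -/
def v (i : ι) : TO ι :=
  ⟨ambientGen i, StarSubalgebra.le_topologicalClosure _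
    (StarAlgebra.subset_adjoin ℂ _ ⟨i, rfl⟩)⟩

lemma isToeplitzCuntzFamily_v : IsToeplitzCuntzFamily (v : ι → TO ι) := by
  refine ⟨fun i => ?_, fun i j hij => ?_⟩
  · apply Subtype.ext
    apply lp.ext
    funext J
    exact J.isFamily.1 i
  · apply Subtype.ext
    apply lp.ext
    funext J
    exact J.isFamily.2 i j hij

/-- Evaluation of the Toeplitz-Cuntz algebra at a family. -/
def evalAt (J : Family ι) : TO ι →⋆ₐ[ℂ] J.B where
  toFun x := (x : Ambient ι) J
  map_one' := rfl
  map_mul' _ _ := rfl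
  map_zero' := rfl
  map_add' _ _ := rfl
  commutes' _ := rfl
  map_star' _ := rfl

open scoped CStarAlgebra in
/-- Unital star homomorphisms out of the Toeplitz-Cuntz algebra are determined by their values on
the generating isometries. -/
theorem TO.hom_ext {B : Type*} [CStarAlgebra B] {f g : TO ι →⋆ₐ[ℂ] B}
    (h : ∀ i, f (v i) = g (v i)) : f = g := by
  refine StarAlgHom.ext_topologicalClosure
    (S := StarAlgebra.adjoin ℂ (Set.range (ambientGen (ι := ι)))) (φ := f) (ψ := g)
    (map_continuous f) (map_continuous g) ?_
  refine StarAlgHom.ext fun x => ?_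
  induction x using StarAlgebra.adjoin_induction_subtype with
  | mem x hx => obtain ⟨i, rfl⟩ := hx; exact h i
  | algebraMap r => simp only [AlgHomClass.commutes]
  | add x y hx hy => simp only [map_add, hx, hy]
  | mul x y hx hy => simp only [map_mul, hx, hy]
  | star x hx => simp only [map_star, hx]

/-- The universal property: every family `w` of isometries with mutually orthogonal ranges in a
nonzero unital C*-algebra is the image of `v` under a unique unital star homomorphism. (A countably
generated C*-algebra has at most the cardinality of the continuum, so that for countable `ι` the
C*-algebras in `Type` are all that matter, up to isomorphism.) -/
theorem TO.lift {B : Type} [CStarAlgebra B] [Nontrivial B] (w : ι → B)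
    (hw : IsToeplitzCuntzFamily w) : ∃! π : TO ι →⋆ₐ[ℂ] B, ∀ i, π (v i) = w i :=
  ⟨evalAt ⟨B, w, hw⟩, fun _ => rfl, fun _ hπ => TO.hom_ext fun i => hπ i⟩

/-! ### The gauge action and its fixed-point algebra -/

/-- The family `z • w i`. -/
def Family.rotate (z : Circle) (J : Family ι) : Family ι where
  B := J.B
  w i := (z : ℂ) • J.w i
  isFamily := by
    have hz : star (z : ℂ) * (z : ℂ) = 1 := by
      simp [← Complex.normSq_eq_conj_mul_self]
    refine ⟨fun i => ?_, fun i j hij => ?_⟩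
    · rw [star_smul, smul_mul_smul_comm, J.isFamily.1, hz, one_smul]
    · rw [star_smul, smul_mul_smul_comm, J.isFamily.2 i j hij, smul_zero]

/-- The star endomorphism of the product algebra given by `(x_w)_w ↦ (x_{z • w})_w`. -/
def ambientRotate (z : Circle) : Ambient ι →⋆ₐ[ℂ] Ambient ι where
  toFun x := ⟨fun J => x (J.rotate z), memℓp_infty (by
    obtain ⟨C, hC⟩ := memℓp_infty_iff.1 (lp.memℓp x)
    refine ⟨C, ?_⟩
    rintro _ ⟨J, rfl⟩
    exact hC ⟨J.rotate z, rfl⟩)⟩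
  map_one' := rfl
  map_mul' _ _ := rfl
  map_zero' := rfl
  map_add' _ _ := rfl
  commutes' _ := rfl
  map_star' _ := rfl

lemma ambientRotate_gen (z : Circle) (i : ι) :
    ambientRotate z (ambientGen i) = (z : ℂ) • ambientGen i := rfl

lemma ambientRotate_norm_le (z : Circle) (x : Ambient ι) : ‖ambientRotate z x‖ ≤ ‖x‖ :=
  lp.norm_le_of_forall_le (norm_nonneg x) fun J =>
    lp.norm_apply_le_norm ENNReal.top_ne_zero x (J.rotate z)

lemma ambientRotate_mem (z : Circle) {x : Ambient ι} (hx : x ∈ toSubalgebra ι) :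
    ambientRotate z x ∈ toSubalgebra ι := by
  have hc : Continuous (ambientRotate (ι := ι) z) :=
    AddMonoidHomClass.continuous_of_bound _ 1 fun x => by
      simpa using ambientRotate_norm_le z x
  have hle : StarAlgebra.adjoin ℂ (Set.range (ambientGen (ι := ι))) ≤
      (toSubalgebra ι).comap (ambientRotate z) := by
    refine StarAlgebra.adjoin_le ?_
    rintro _ ⟨i, rfl⟩
    change ambientRotate z (ambientGen i) ∈ toSubalgebra ι
    rw [ambientRotate_gen]
    exact (toSubalgebra ι).smul_mem (v i).2 _
  have hcl : IsClosed ((toSubalgebra ι).comap (ambientRotate z) : Set (Ambient ι)) :=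
    (inferInstance : IsClosed (toSubalgebra ι : Set (Ambient ι))).preimage hc
  exact StarSubalgebra.topologicalClosure_minimal hle hcl hx

/-- The gauge action of the circle: `gauge z` is the star endomorphism (in fact automorphism) of the
Toeplitz-Cuntz algebra with `gauge z (v i) = z • v i`. -/
def gauge (z : Circle) : TO ι →⋆ₐ[ℂ] TO ι where
  toFun x := ⟨ambientRotate z x, ambientRotate_mem z x.2⟩
  map_one' := rfl
  map_mul' _ _ := rfl
  map_zero' := rfl
  map_add' _ _ := rfl
  commutes' _ := rfl
  map_star' _ := rfl

lemma gauge_v (z : Circle) (i : ι) : gauge z (v i) = (z : ℂ) • v i := rfl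

/-- `gauge z` is the only star endomorphism with `v i ↦ z • v i`. -/
lemma gauge_unique (z : Circle) (f : TO ι →⋆ₐ[ℂ] TO ι) (h : ∀ i, f (v i) = (z : ℂ) • v i) :
    f = gauge z :=
  TO.hom_ext fun i => (h i).trans (gauge_v z i).symm

lemma continuous_gauge (z : Circle) : Continuous (gauge (ι := ι) z) :=
  AddMonoidHomClass.continuous_of_bound _ 1 fun x => by
    rw [one_mul]
    exact ambientRotate_norm_le z (x : Ambient ι)

/-- The fixed-point algebra `ℱ_n` of the gauge action. -/
def fixedAlg (ι : Type) : StarSubalgebra ℂ (TO ι) where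
  carrier := {x | ∀ z : Circle, gauge z x = x}
  mul_mem' hx hy z := by rw [map_mul, hx z, hy z]
  one_mem' z := map_one _
  add_mem' hx hy z := by rw [map_add, hx z, hy z]
  zero_mem' z := map_zero _
  algebraMap_mem' r z := AlgHomClass.commutes _ r
  star_mem' hx z := by rw [map_star, hx z]

/-- The word `v_μ = v_{μ 0} ⋯ v_{μ (k-1)}`. -/
def word {k : ℕ} (μ : Fin k → ι) : TO ι := (List.ofFn fun j => v (μ j)).prod

lemma gauge_word (z : Circle) {k : ℕ} (μ : Fin k → ι) :
    gauge z (word μ) = (z : ℂ) ^ k • word μ := by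
  induction k with
  | zero => simp [word]
  | succ k ih =>
    have h : word μ = v (μ 0) * word (fun j => μ j.succ) := by simp [word, List.ofFn_succ]
    rw [h, map_mul, ih, gauge_v, smul_mul_smul_comm, pow_succ']

/-- The monomial `v_μ v_ν^*`, for words of equal length, as an element of `ℱ_n`. -/
def fixedMonomial {k : ℕ} (μ ν : Fin k → ι) : fixedAlg ι :=
  ⟨word μ * star (word ν), fun z => by
    have hz : (z : ℂ) * star (z : ℂ) = 1 := by simp [Complex.mul_conj]
    rw [map_mul, map_star, gauge_word, gauge_word, star_smul, smul_mul_smul_comm, star_pow,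
      ← mul_pow, hz, one_pow, one_smul]⟩

/-! ### States -/

section States

variable {A : Type*} [TopologicalSpace A] [Ring A] [StarRing A] [Algebra ℂ A]

/-- The set of states: positive (continuous) linear functionals with value `1` at `1`. -/
def stateSpace (A : Type*) [TopologicalSpace A] [Ring A] [StarRing A] [Algebra ℂ A] :
    Set (WeakDual ℂ A) :=
  {φ | (∀ x : A, 0 ≤ φ (star x * x)) ∧ φ 1 = 1}

/-- A pure state is an extreme point of the state space. -/
def IsPureState (φ : WeakDual ℂ A) : Prop := φ ∈ (stateSpace A).extremePoints ℝ

/-- `(π, ξ)` is the GNS representation of `φ` (up to unitary equivalence): `ξ` is a cyclic vector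
for `π` which implements `φ`. -/
structure IsGNS (φ : WeakDual ℂ A) {H : Type*} [NormedAddCommGroup H]
    [InnerProductSpace ℂ H] [CompleteSpace H] (π : A →⋆ₐ[ℂ] (H →L[ℂ] H)) (ξ : H) : Prop where
  cyclic : DenseRange fun x : A => π x ξ
  apply_eq : ∀ x : A, φ x = ⟪ξ, π x ξ⟫_ℂ

end States

/-- A state of `ℱ_n` is essential if, in its GNS representation `π`, for every `k` the projections
`π (v_μ v_μ^*)`, over the words `μ` of length `k`, sum strongly to the identity. -/
def IsEssential (ρ : WeakDual ℂ (fixedAlg ι)) : Prop :=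
  ∀ (H : Type 1) [NormedAddCommGroup H] [InnerProductSpace ℂ H] [CompleteSpace H]
    (π : fixedAlg ι →⋆ₐ[ℂ] (H →L[ℂ] H)) (ξ : H), IsGNS ρ π ξ →
    ∀ (k : ℕ) (h : H), HasSum (fun μ : Fin k → ι => π (fixedMonomial μ μ) h) h

/-! ### Product states and their period -/

/-- The Hilbert space `ℰ`, the closed linear span of the isometries `v i`, with orthonormal basis
`(v i)`, identified with `ℓ²(ι)`: the vector `v i` is `basisVec i`. -/
def E (ι : Type) : Type := lp (fun _ : ι => ℂ) 2

instance : NormedAddCommGroup (E ι) := inferInstanceAs (NormedAddCommGroup (lp (fun _ : ι => ℂ) 2))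

instance : InnerProductSpace ℂ (E ι) :=
  inferInstanceAs (InnerProductSpace ℂ (lp (fun _ : ι => ℂ) 2))

instance : CompleteSpace (E ι) := inferInstanceAs (CompleteSpace (lp (fun _ : ι => ℂ) 2))

open Classical in
/-- The basis vector `v i` of `ℰ`. -/
def basisVec (i : ι) : E ι := (lp.single 2 i (1 : ℂ) : lp (fun _ : ι => ℂ) 2)

/-- The compact operators on `ℰ`. -/
abbrev K (ι : Type) : Submodule ℂ (E ι →L[ℂ] E ι) := compactOperator (RingHom.id ℂ) (E ι) (E ι)

/-- The rank-one operator `h ↦ ⟨h, v j⟩ v i` (inner product linear in `h`). -/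
def matrixUnit (i j : ι) : K ι :=
  ⟨InnerProductSpace.rankOne ℂ (basisVec i) (basisVec j), by
    rw [InnerProductSpace.rankOne_def']
    exact ((isCompactOperator_id (E := ℂ)).clm_comp
      (ContinuousLinearMap.toSpanSingleton ℂ (basisVec i))).comp_clm _⟩

/-- States of the C*-algebra of compact operators: positive linear functionals of norm one. -/
def IsStateOnK (φ : K ι →L[ℂ] ℂ) : Prop :=
  (∀ T S : K ι, (T : E ι →L[ℂ] E ι) = star (S : E ι →L[ℂ] E ι) * S → 0 ≤ φ T) ∧ ‖φ‖ = 1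

/-- The vector functional `T ↦ ⟨T e, e⟩` (inner product linear in the first variable). -/
def vectorState (e : E ι) : K ι →L[ℂ] ℂ :=
  (innerSL ℂ e).comp ((ContinuousLinearMap.apply ℂ (E ι) e).comp (K ι).subtypeL)

/-- `ρ` is the product state determined by the functionals `φ 0, φ 1, …` on `K(ℰ)`:
`ρ (v_{i_1} ⋯ v_{i_m} v_{j_m}^* ⋯ v_{j_1}^*) = ∏ k, φ_k (v_{i_k} ⊗ v_{j_k}^*)`. -/
def IsProductOf (ρ : WeakDual ℂ (fixedAlg ι)) (φ : ℕ → (K ι →L[ℂ] ℂ)) : Prop :=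
  ∀ (m : ℕ) (μ ν : Fin m → ι), ρ (fixedMonomial μ ν) = ∏ k : Fin m, φ k (matrixUnit (μ k) (ν k))

/-- Product states of `ℱ_n`. -/
def IsProductState (ρ : WeakDual ℂ (fixedAlg ι)) : Prop :=
  ρ ∈ stateSpace (fixedAlg ι) ∧
    ∃ φ : ℕ → (K ι →L[ℂ] ℂ), (∀ k, IsStateOnK (φ k)) ∧ IsProductOf ρ φ

/-- `e` is a sequence of unit vectors and `ρ` is the product state of the corresponding vector
states. -/
def IsVectorProduct (ρ : WeakDual ℂ (fixedAlg ι)) (e : ℕ → E ι) : Prop :=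
  (∀ k, ‖e k‖ = 1) ∧ IsProductOf ρ fun k => vectorState (e k)

/-- `p` is the period of the sequence `e`: the smallest positive integer for which
`∑ i, (1 - |⟨e_i, e_{i+p}⟩|)` converges. -/
def IsPeriodOfSeq (e : ℕ → E ι) (p : ℕ) : Prop :=
  IsLeast {q : ℕ | 0 < q ∧ Summable fun i => 1 - ‖⟪e i, e (i + q)⟫_ℂ‖} p

/-- The pure product state `ρ` has (finite) period `p`: it is the product state of the vector states
of a sequence of unit vectors of period `p`. (The vectors are unique up to phases, which do not
affect the period.) -/
def HasPeriod (ρ : WeakDual ℂ (fixedAlg ι)) (p : ℕ) : Prop :=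
  ∃ e : ℕ → E ι, IsVectorProduct ρ e ∧ IsPeriodOfSeq e p

/-! ### Pure extensions and the extensions given by measures on the circle -/

/-- `τ` extends `ρ` from `ℱ_n` to the Toeplitz-Cuntz algebra. -/
def Extends (τ : WeakDual ℂ (TO ι)) (ρ : WeakDual ℂ (fixedAlg ι)) : Prop :=
  ∀ x : fixedAlg ι, τ (x : TO ι) = ρ x

/-- The extensions of `ρ` to pure states of the Toeplitz-Cuntz algebra, with the weak-* topology. -/
def pureExtensions (ρ : WeakDual ℂ (fixedAlg ι)) : Set (WeakDual ℂ (TO ι)) :=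
  {τ | IsPureState τ ∧ Extends τ ρ}

/-- The action of the gauge group on functionals, `τ ↦ τ ∘ gauge z`. -/
def gaugeAct (z : Circle) (τ : WeakDual ℂ (TO ι)) : WeakDual ℂ (TO ι) :=
  StrongDual.toWeakDual ((WeakDual.toStrongDual τ).comp
    ⟨(gauge (ι := ι) z).toAlgHom.toLinearMap, continuous_gauge z⟩)

lemma gaugeAct_apply (z : Circle) (τ : WeakDual ℂ (TO ι)) (x : TO ι) :
    gaugeAct z τ x = τ (gauge z x) := rfl

/-- The circle with its Borel sets. -/
instance : MeasurableSpace Circle := borel Circle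

instance : BorelSpace Circle := ⟨rfl⟩

/-- The Fourier transform of a probability measure on the circle, `a ↦ ∫ z^{-a} dσ(z)`. -/
def fourierTransform (σ : ProbabilityMeasure Circle) (a : ℤ) : ℂ :=
  ∫ z : Circle, (z : ℂ) ^ (-a) ∂(σ : Measure Circle)

/-- The point measure at `z`. -/
def pointMeasure (z : Circle) : ProbabilityMeasure Circle :=
  ⟨Measure.dirac z, inferInstance⟩

/-- The functional `τ` is `ρ_σ`, where `e` is a sequence of unit vectors: for
`μ = (i_1, …, i_k)` and `ν = (j_1, …, j_l)`,
`τ (v_μ v_ν^*) = λ_{k,l} ⟨v_{i_1}, e_1⟩ ⋯ ⟨v_{i_k}, e_k⟩ ⟨e_l, v_{j_l}⟩ ⋯ ⟨e_1, v_{j_1}⟩`, where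
`λ_{k,l} = σ^((k - l) / p) ∏_{i ≥ 1} ⟨e_{l+i}, e_{k+i}⟩` if `p` divides `k - l`, and `λ_{k,l} = 0`
otherwise. The infinite product is the limit of its partial products. Inner products in this comment
are linear in the first variable, those of the code in the second, and `e_i` is `e (i - 1)`. -/
def IsGivenBy (e : ℕ → E ι) (p : ℕ) (σ : ProbabilityMeasure Circle) (τ : WeakDual ℂ (TO ι)) :
    Prop :=
  ∀ (k l : ℕ), ∃ c : ℂ,
    (∀ a : ℤ, (k : ℤ) - l = p * a → ∃ P : ℂ,
      Tendsto (fun N => ∏ i ∈ Finset.range N, ⟪e (k + i), e (l + i)⟫_ℂ) atTop (𝓝 P) ∧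
        c = fourierTransform σ a * P) ∧
    (¬ (p : ℤ) ∣ (k : ℤ) - l → c = 0) ∧
    ∀ (μ : Fin k → ι) (ν : Fin l → ι),
      τ (word μ * star (word ν)) =
        c * (∏ j : Fin k, ⟪e j, basisVec (μ j)⟫_ℂ) * ∏ j : Fin l, ⟪basisVec (ν j), e j⟫_ℂ

end ToeplitzCuntz

/-! Let W_N = V(e_0)⋯V(e_{N-1}). Among the states of `TO ι`, the extensions of ρ are those with
τ(W_N W_N^*) = 1 for all N (`adapted`). Such a state absorbs these projections on either side, and
compression by them shows that it is determined by its coefficients c(k,l) = τ(W_k W_l^*)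
(`apply_word`), which satisfy c(k,l) = ∏_{i<M} ⟪e_{k+i}, e_{l+i}⟫ · c(k+M, l+M) (`coeff_eq`). If p
does not divide k - l, the partial products tend to 0 and c(k,l) = 0. If k - l = pa, the choice of
phases makes them converge to a limit P(k,l), nonzero far out, and c(k,l) = m(a) P(k,l) for a number
m(a) which depends on a alone.

The heart is that purity forces m(a) = z^a for a point z of the circle (`exists_coeff_eq_of_pure`).
The partial isometries u_N = W_{N+p} W_N^* asymptotically fix an adapted state: τ(u_N^* x u_N) →
τ(x), because e_{n+pb} - e_n → 0 in norm. By Cauchy–Schwarz the limit F(x) = lim τ(x u_N) along an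
ultrafilter satisfies |F(x^*x)| ≤ τ(x^*x), so F = F(1) τ by purity. Since right multiplication by
u_N raises k - l by p, this reads m(a+1) = F(1) m(a), and |F(1)| = 1.

Existence is soft. The adapted states form a nonempty compact face of the state space, so by
Krein–Milman one of them is pure (`exists_pure_adapted`). The gauge automorphism at w moves the
parameter z to w^p z; hence every z occurs, with a pure state, and the action is p-to-1 and
transitive. Integrating the point states against σ gives ρ_σ. If ρ_σ is pure, the first Fourier
coefficient of σ has modulus one, which makes σ a point measure. Finally z ↦ ρ_{δ_z} is a continuous
bijection from a compact space to a Hausdorff space. -/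

namespace ToeplitzCuntz

/-! ### Positive functionals and pure states -/

section PositiveFunctionals

variable {A : Type*} [CStarAlgebra A] {φ ψ : WeakDual ℂ A}

/-- Positivity of a functional on a C*-algebra. -/
def IsPositive (φ : WeakDual ℂ A) : Prop := ∀ x : A, 0 ≤ φ (star x * x)

/-- Polarization: the values on the squares of `1`, `x`, `1 + x` and `1 + I • x` are real. -/
lemma IsPositive.map_star (h : IsPositive φ) (x : A) : φ (star x) = star (φ x) := by
  have h0 := (Complex.nonneg_iff.1 (h x)).2
  have h1 := (Complex.nonneg_iff.1 (h 1)).2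
  have h2 := (Complex.nonneg_iff.1 (h (1 + x))).2
  have h3 := (Complex.nonneg_iff.1 (h (1 + Complex.I • x))).2
  simp only [star_add, star_one, star_smul, mul_add, add_mul, one_mul, mul_one, map_add,
    smul_mul_assoc, mul_smul_comm, map_smul, Complex.add_im, smul_eq_mul, Complex.mul_im,
    Complex.star_def, Complex.conj_I, Complex.neg_re, Complex.neg_im, Complex.I_re,
    Complex.I_im] at h1 h2 h3
  rw [← h0] at h2 h3
  apply Complex.ext <;> simp at * <;> linarith

/-- The sesquilinear form of a positive functional. -/
@[reducible] def IsPositive.core (h : IsPositive φ) : PreInnerProductSpace.Core ℂ A where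
  inner x y := φ (star x * y)
  conj_inner_symm x y := by
    have := h.map_star (star y * x)
    rw [star_mul, star_star] at this
    rw [this]; simp
  re_inner_nonneg x := (Complex.nonneg_iff.1 (h x)).1
  add_left x y z := by simp [add_mul]
  smul_left x y r := by simp

lemma IsPositive.norm_sq_le (h : IsPositive φ) (x y : A) :
    ‖φ (star x * y)‖ ^ 2 ≤ (φ (star x * x)).re * (φ (star y * y)).re := by
  have := @InnerProductSpace.Core.inner_mul_inner_self_le ℂ A _ _ _ h.core x y
  have h2 : φ (star y * x) = star (φ (star x * y)) := by
    rw [← h.map_star, star_mul, star_star]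
  change ‖φ (star x * y)‖ * ‖φ (star y * x)‖ ≤ _ at this
  rw [h2, norm_star, ← pow_two] at this
  exact this

/-- In the spectral order x^*x ≤ ‖x‖² 1, so the difference has the form b^*b. With Cauchy–Schwarz
this makes states contractive. -/
lemma IsPositive.apply_le (h : IsPositive φ) (x : A) :
    (φ (star x * x)).re ≤ ‖x‖ ^ 2 * (φ 1).re := by
  let _ : PartialOrder A := CStarAlgebra.spectralOrder A
  have _ : StarOrderedRing A := CStarAlgebra.spectralOrderedRing A
  have h1 := CStarAlgebra.star_mul_le_algebraMap_norm_sq (a := x)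
  obtain ⟨b, hb⟩ := CStarAlgebra.nonneg_iff_eq_star_mul_self.1 (sub_nonneg.2 h1)
  have h2 := (Complex.nonneg_iff.1 (h b)).1
  have h3 : algebraMap ℝ A (‖x‖ ^ 2) = ((‖x‖ ^ 2 : ℝ) : ℂ) • (1 : A) := by
    rw [Algebra.algebraMap_eq_smul_one, Complex.coe_smul]
  rw [← hb, h3, map_sub, map_smul, smul_eq_mul, Complex.sub_re, Complex.re_ofReal_mul] at h2
  linarith

lemma isPositive_of_mem (h : φ ∈ stateSpace A) : IsPositive φ := h.1

lemma norm_apply_le_of_mem_stateSpace (h : φ ∈ stateSpace A) (x : A) : ‖φ x‖ ≤ ‖x‖ := by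
  have h1 := (isPositive_of_mem h).norm_sq_le 1 x
  have h2 := (isPositive_of_mem h).apply_le x
  simp only [star_one, one_mul, h.2, Complex.one_re, mul_one] at h1 h2
  exact (pow_le_pow_iff_left₀ (norm_nonneg _) (norm_nonneg _) two_ne_zero).1 (h1.trans h2)

/-- Elements on which a state is one, when they are projections, are absorbed on the right. -/
lemma apply_mul_of_apply_eq_one (h : φ ∈ stateSpace A) {q : A} (hq : star q * q = q)
    (h1 : φ q = 1) (x : A) : φ (x * q) = φ x := by
  have hs : star q = q := by
    have := congrArg star hq
    rw [star_mul, star_star, hq] at this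
    exact this.symm
  -- Cauchy–Schwarz against the projection `1 - q`, on which the state vanishes.
  have h2 := (isPositive_of_mem h).norm_sq_le (star x) (1 - q)
  have h3 : star (1 - q) * (1 - q) = 1 - q := by
    rw [star_sub, star_one, hs, sub_mul, one_mul, mul_sub, mul_one]
    have hqq : q * q = q := by rwa [hs] at hq
    rw [hqq]; simp
  rw [h3, map_sub, h.2, h1, sub_self, Complex.zero_re, mul_zero, star_star] at h2
  have h4 : φ (x * (1 - q)) = 0 := by
    rw [← norm_eq_zero]; nlinarith [norm_nonneg (φ (x * (1 - q)))]
  rw [mul_sub, mul_one, map_sub, sub_eq_zero] at h4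
  exact h4.symm

lemma apply_mul_of_apply_eq_one_left (h : φ ∈ stateSpace A) {q : A} (hq : star q * q = q)
    (h1 : φ q = 1) (x : A) : φ (q * x) = φ x := by
  have hs : star q = q := by
    have := congrArg star hq
    rw [star_mul, star_star, hq] at this
    exact this.symm
  have := apply_mul_of_apply_eq_one h hq h1 (star x)
  rw [← star_inj, ← (isPositive_of_mem h).map_star, ← (isPositive_of_mem h).map_star, star_mul, hs,
    star_star] at this
  exact this

/-- The functional `x ↦ φ (a * x * b)`. -/
def mulFunctional (φ : WeakDual ℂ A) (a b : A) : WeakDual ℂ A :=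
  StrongDual.toWeakDual ((WeakDual.toStrongDual φ).comp (((ContinuousLinearMap.mul ℂ A).flip b).comp
    (ContinuousLinearMap.mul ℂ A a)))

@[simp] lemma mulFunctional_apply (φ : WeakDual ℂ A) (a b x : A) :
    mulFunctional φ a b x = φ (a * x * b) := rfl

lemma IsPositive.conj (h : IsPositive φ) (a : A) : IsPositive (mulFunctional φ (star a) a) := by
  intro x
  have := h (x * a)
  rw [mulFunctional_apply]
  rwa [star_mul, ← mul_assoc, mul_assoc (star a)] at this

/-- The functional `x ↦ conj (φ (star x))`. -/
def conjFunctional (φ : WeakDual ℂ A) : WeakDual ℂ A :=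
  StrongDual.toWeakDual
    { toFun := fun x => star (φ (star x))
      map_add' := by simp
      map_smul' := by simp
      cont := by
        have : Continuous (fun x => φ x) := (WeakDual.toStrongDual φ).continuous
        fun_prop }

/-- A functional dominated on the diagonal by a pure state, and hermitian, is a multiple of it. -/
lemma IsPureState.eq_smul_of_hermitian (h : IsPureState φ) {R : WeakDual ℂ A}
    (hre : ∀ x, (R (star x * x)).im = 0) (hR : ∀ x, ‖R (star x * x)‖ ≤ (φ (star x * x)).re / 2)
    (x : A) : R x = R 1 * φ x := by
  have hφ := isPositive_of_mem h.1
  have h1 : φ 1 = 1 := h.1.2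
  have hr : R 1 = ((R 1).re : ℂ) := by
    have := hre 1
    simp only [star_one, one_mul] at this
    apply Complex.ext <;> simp [this]
  set r := (R 1).re with hrdef
  have hr1 : |r| ≤ 1 / 2 := by
    have := hR 1
    simp only [star_one, one_mul, h1, Complex.one_re] at this
    rw [hr, Complex.norm_real] at this
    simpa using this
  obtain ⟨hl, hu⟩ := abs_le.1 hr1
  -- The bound by one half of φ keeps `1 + s * r` positive for both signs, so φ + R and φ - R can be
  -- normalized to states.
  have key : ∀ s : ℝ, |s| = 1 → ((((1 + s * r)⁻¹ : ℝ) : ℂ) • (φ + ((s : ℝ) : ℂ) • R)) ∈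
      stateSpace A := by
    intro s hs
    have hsr : 0 < 1 + s * r := by
      have : |s * r| ≤ 1 / 2 := by rw [abs_mul, hs, one_mul]; exact hr1
      linarith [(abs_le.1 this).1]
    refine ⟨fun x => ?_, ?_⟩
    · have h2 := Complex.nonneg_iff.1 (hφ x)
      have h3 := hre x
      have h4 : |s * (R (star x * x)).re| ≤ (φ (star x * x)).re := by
        rw [abs_mul, hs, one_mul]
        exact (Complex.abs_re_le_norm _).trans ((hR x).trans (by linarith [h2.1]))
      change 0 ≤ (((1 + s * r)⁻¹ : ℝ) : ℂ) * (φ (star x * x) + (s : ℂ) * R (star x * x))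
      refine mul_nonneg (by exact_mod_cast (inv_pos.2 hsr).le) ?_
      rw [Complex.nonneg_iff]
      constructor
      · simp only [Complex.add_re, Complex.re_ofReal_mul]
        linarith [(abs_le.1 h4).1]
      · simp only [Complex.add_im, Complex.im_ofReal_mul]
        rw [h3, ← h2.2]; simp
    · change (((1 + s * r)⁻¹ : ℝ) : ℂ) * (φ 1 + (s : ℂ) * R 1) = 1
      rw [h1, hr]
      have : (1 + s * r : ℂ) ≠ 0 := by exact_mod_cast hsr.ne'
      push_cast
      field_simp
  have hp := key 1 (by simp)
  have hm := key (-1) (by simp)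
  -- φ is half the sum of φ + R and φ - R; after normalization the weights become (1 ± r)/2.
  have hseg : φ ∈ openSegment ℝ
      ((((1 + 1 * r)⁻¹ : ℝ) : ℂ) • (φ + ((1 : ℝ) : ℂ) • R))
      ((((1 + -1 * r)⁻¹ : ℝ) : ℂ) • (φ + ((-1 : ℝ) : ℂ) • R)) := by
    refine ⟨(1 + r) / 2, (1 - r) / 2, by linarith, by linarith, by ring, ?_⟩
    refine ContinuousLinearMap.ext fun x => ?_
    have e1 : (1 + r : ℂ) ≠ 0 := by exact_mod_cast (show (1 + r : ℝ) ≠ 0 by linarith)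
    have e2 : (1 + -r : ℂ) ≠ 0 := by exact_mod_cast (show (1 + -r : ℝ) ≠ 0 by linarith)
    change ((((1 + r) / 2 : ℝ) • ((((1 + 1 * r)⁻¹ : ℝ) : ℂ) * (φ x + ((1 : ℝ) : ℂ) * R x)) +
      ((1 - r) / 2 : ℝ) • ((((1 + -1 * r)⁻¹ : ℝ) : ℂ) * (φ x + ((-1 : ℝ) : ℂ) * R x)) : ℂ)) = φ x
    simp only [Complex.real_smul]
    push_cast
    simp only [one_mul, neg_mul]
    field_simp
    ring
  have h5 := h.2 hp hm hseg
  have h6 : (((1 + 1 * r)⁻¹ : ℝ) : ℂ) * (φ x + ((1 : ℝ) : ℂ) * R x) = φ x :=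
    congrArg (fun f : WeakDual ℂ A => f x) h5
  have e1 : (1 + r : ℂ) ≠ 0 := by exact_mod_cast (show (1 + r : ℝ) ≠ 0 by linarith)
  push_cast at h6
  rw [one_mul, one_mul] at h6
  rw [hr]
  field_simp at h6
  linear_combination h6

/-- A functional dominated on the diagonal by a pure state is a multiple of it. -/
lemma IsPureState.eq_smul_of_norm_le (h : IsPureState φ) {F : WeakDual ℂ A}
    (hF : ∀ x, ‖F (star x * x)‖ ≤ (φ (star x * x)).re) (x : A) : F x = F 1 * φ x := by
  -- On the diagonal, cF plus its conjugate is real and at most 2φ in modulus, so a quarter of it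
  -- meets the bound φ/2 of the hermitian case. The choices c = 1 and c = i together recover F.
  have key : ∀ c : ℂ, ‖c‖ = 1 → c * F x + star (c * F (star x)) =
      (c * F 1 + star (c * F 1)) * φ x := by
    intro c hc
    have h2 := h.eq_smul_of_hermitian
      (R := (4 : ℂ)⁻¹ • (c • F + conjFunctional (c • F))) ?_ ?_ x
    · change (4 : ℂ)⁻¹ * (c * F x + star (c * F (star x))) =
        (4 : ℂ)⁻¹ * (c * F 1 + star (c * F (star 1))) * φ x at h2
      rw [star_one] at h2
      linear_combination 4 * h2
    · intro y
      change ((4 : ℂ)⁻¹ * (c * F (star y * y) + star (c * F (star (star y * y))))).im = 0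
      rw [show star (star y * y) = star y * y by rw [star_mul, star_star]]
      have : ((4 : ℂ)⁻¹) = ((4⁻¹ : ℝ) : ℂ) := by push_cast; rfl
      rw [this, Complex.im_ofReal_mul]
      simp
      ring
    · intro y
      change ‖(4 : ℂ)⁻¹ * (c * F (star y * y) + star (c * F (star (star y * y))))‖ ≤ _
      rw [show star (star y * y) = star y * y by rw [star_mul, star_star], norm_mul]
      have h3 : ‖c * F (star y * y)‖ ≤ (φ (star y * y)).re := by
        rw [norm_mul, hc, one_mul]; exact hF y
      have h4 := norm_add_le (c * F (star y * y)) (star (c * F (star y * y)))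
      rw [norm_star] at h4
      have : ‖(4 : ℂ)⁻¹‖ = 4⁻¹ := by simp
      rw [this]
      linarith
  have h1 := key 1 (by simp)
  have h2 := key Complex.I (by simp)
  simp only [one_mul, star_mul, Complex.star_def, Complex.conj_I] at h1 h2
  have hI := Complex.I_sq
  linear_combination (1 / 2) * h1 - (Complex.I / 2) * h2 +
    (1 / 2) * (F x - F 1 * φ x - (starRingEnd ℂ) (F (star x)) + (starRingEnd ℂ) (F 1) * φ x) * hI

/-- Local convexity is what Krein–Milman needs in `exists_pure_adapted`. -/
instance instLocallyConvexSpaceWeakDual : LocallyConvexSpace ℝ (WeakDual ℂ A) := by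
  let f : WeakDual ℂ A →ₗ[ℝ] (A → ℂ) :=
    { toFun := fun φ x => φ x
      map_add' := fun _ _ => rfl
      map_smul' := fun _ _ => rfl }
  have hf : IsInducing f := ⟨rfl⟩
  exact hf.locallyConvexSpace

/-- Bounded families of functionals have pointwise limits along ultrafilters. -/
lemma exists_ultralimit (U : Ultrafilter ℕ) (g : ℕ → WeakDual ℂ A)
    (hg : ∀ n x, ‖g n x‖ ≤ ‖x‖) : ∃ G : WeakDual ℂ A, ∀ x, Tendsto (fun n => g n x) U (𝓝 (G x)) := by
  have hc := WeakDual.isCompact_closedBall (𝕜 := ℂ) (E := A) 0 1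
  obtain ⟨G, -, hG⟩ := hc.ultrafilter_le_nhds (U.map g) (by
    rw [Filter.le_principal_iff]
    refine Filter.mem_map.2 (Filter.univ_mem' fun n => ?_)
    simp only [Set.mem_preimage, mem_closedBall_zero_iff]
    exact ContinuousLinearMap.opNorm_le_bound _ zero_le_one fun x => by
      rw [one_mul]; exact hg n x)
  refine ⟨G, fun x => ?_⟩
  exact ((WeakDual.eval_continuous x).tendsto G).comp (show Tendsto g U (𝓝 G) from hG)

lemma mem_stateSpace_of_tendsto {U : Filter ℕ} [U.NeBot] {g : ℕ → WeakDual ℂ A} {G : WeakDual ℂ A}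
    (hG : ∀ x, Tendsto (fun n => g n x) U (𝓝 (G x))) (hp : ∀ n, IsPositive (g n))
    (h1 : ∀ᶠ n in U, g n 1 = 1) : G ∈ stateSpace A := by
  refine ⟨fun x => ge_of_tendsto' (hG _) fun n => hp n x, ?_⟩
  exact tendsto_nhds_unique (hG 1) (tendsto_const_nhds.congr' (h1.mono fun n hn => hn.symm))

lemma isCompact_stateSpace : IsCompact (stateSpace A) := by
  refine (WeakDual.isCompact_closedBall (𝕜 := ℂ) (E := A) 0 1).of_isClosed_subset ?_ ?_
  · have : stateSpace A = (⋂ x : A, {φ : WeakDual ℂ A | 0 ≤ φ (star x * x)}) ∩ {φ | φ 1 = 1} := by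
      ext φ; simp [stateSpace]
    rw [this]
    refine IsClosed.inter (isClosed_iInter fun x => ?_) ?_
    · exact isClosed_Ici.preimage (WeakDual.eval_continuous _)
    · exact isClosed_singleton.preimage (WeakDual.eval_continuous _)
  · intro φ hφ
    simp only [Set.mem_preimage, mem_closedBall_zero_iff]
    exact ContinuousLinearMap.opNorm_le_bound _ zero_le_one fun x => by
      rw [one_mul]; exact norm_apply_le_of_mem_stateSpace hφ x

end PositiveFunctionals

end ToeplitzCuntz

namespace ToeplitzCuntz

variable {ι : Type}

/-! ### Families of isometries on Hilbert spaces -/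

lemma isToeplitzCuntzFamily_of_isometries {H : Type*} [NormedAddCommGroup H]
    [InnerProductSpace ℂ H] [CompleteSpace H] (T : ι → H →ₗᵢ[ℂ] H)
    (h : ∀ i j, i ≠ j → ∀ f g, ⟪T i f, T j g⟫_ℂ = 0) :
    IsToeplitzCuntzFamily fun i => ((T i).toContinuousLinearMap : H →L[ℂ] H) := by
  refine ⟨fun i => ContinuousLinearMap.ext fun f => ext_inner_left ℂ fun g => ?_,
    fun i j hij => ContinuousLinearMap.ext fun f => ext_inner_left ℂ fun g => ?_⟩
  · change ⟪g, ContinuousLinearMap.adjoint (T i).toContinuousLinearMap (T i f)⟫_ℂ = ⟪g, f⟫_ℂ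
    rw [ContinuousLinearMap.adjoint_inner_right]
    exact (T i).inner_map_map g f
  · change ⟪g, ContinuousLinearMap.adjoint (T i).toContinuousLinearMap (T j f)⟫_ℂ = ⟪g, 0⟫_ℂ
    rw [ContinuousLinearMap.adjoint_inner_right, inner_zero_right]
    exact h i j hij g f

/-- The full Fock space, with orthonormal basis the words. -/
abbrev Fock (ι : Type) : Type := lp (fun _ : List ι => ℂ) 2

open Classical in
/-- The basis vector of the Fock space at a word. -/
def fockVec (μ : List ι) : Fock ι := lp.single 2 μ (1 : ℂ)

lemma fockVec_inner (μ ν : List ι) (h : μ ≠ ν) : ⟪fockVec μ, fockVec ν⟫_ℂ = 0 := by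
  classical
  unfold fockVec
  rw [lp.inner_single_left, lp.single_apply_ne _ _ _ h, inner_zero_right]

lemma norm_fockVec (μ : List ι) : ‖fockVec μ‖ = 1 := by
  classical
  unfold fockVec
  rw [lp.norm_single (by norm_num)]; simp

lemma orthonormal_fockVec_cons (i : ι) : Orthonormal ℂ (fun w : List ι => fockVec (i :: w)) :=
  ⟨fun _ => norm_fockVec _, fun _ _ h => fockVec_inner _ _ fun h' => h (List.cons.inj h').2⟩

/-- The left creation operators, as isometries. -/
def creation (i : ι) : Fock ι →ₗᵢ[ℂ] Fock ι :=
  (orthonormal_fockVec_cons i).orthogonalFamily.linearIsometry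

lemma hasSum_creation (i : ι) (f : Fock ι) :
    HasSum (fun w => f w • fockVec (i :: w)) (creation i f) :=
  (orthonormal_fockVec_cons i).orthogonalFamily.hasSum_linearIsometry f

lemma creation_inner (i j : ι) (h : i ≠ j) (f g : Fock ι) :
    ⟪creation i f, creation j g⟫_ℂ = 0 := by
  have h1 : ∀ ν, ⟪creation i f, fockVec (j :: ν)⟫_ℂ = 0 := by
    intro ν
    rw [← inner_conj_symm]
    have := (hasSum_creation i f).mapL (innerSL ℂ (fockVec (j :: ν)))
    have h0 : ⟪fockVec (j :: ν), creation i f⟫_ℂ = 0 := by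
      refine this.unique ?_
      convert hasSum_zero with μ
      simp [fockVec_inner (j :: ν) (i :: μ) (fun h' => h (List.cons.inj h').1.symm)]
    rw [h0, map_zero]
  have := (hasSum_creation j g).mapL (innerSL ℂ (creation i f))
  refine this.unique ?_
  convert hasSum_zero with μ
  simp [h1]

instance : Nontrivial (Fock ι) :=
  ⟨fockVec [], 0, fun h => by have := norm_fockVec ([] : List ι); rw [h] at this; simp at this⟩

/-- The family of left creation operators. -/
def fockFamily (ι : Type) : Family ι where
  B := Fock ι →L[ℂ] Fock ι
  w i := (creation i).toContinuousLinearMap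
  isFamily := isToeplitzCuntzFamily_of_isometries creation creation_inner

-- A vector state. In the Fock representation it gives the initial state from which adapted states
-- are built.
open scoped CStarAlgebra in
lemma stateSpace_nonempty {A : Type*} [CStarAlgebra A] {H : Type*} [NormedAddCommGroup H]
    [InnerProductSpace ℂ H] [CompleteSpace H] [Nontrivial H] (π : A →⋆ₐ[ℂ] (H →L[ℂ] H)) :
    (stateSpace A).Nonempty := by
  obtain ⟨Ω, hΩ⟩ := exists_norm_eq H zero_le_one
  let L : A →L[ℂ] (H →L[ℂ] H) := ⟨π.toAlgHom.toLinearMap, map_continuous π⟩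
  let φ : WeakDual ℂ A := StrongDual.toWeakDual
    ((innerSL ℂ Ω).comp ((ContinuousLinearMap.apply ℂ H Ω).comp L))
  have hφ : ∀ x, φ x = ⟪Ω, π x Ω⟫_ℂ := fun x => rfl
  refine ⟨φ, fun x => ?_, ?_⟩
  · rw [hφ, map_mul, map_star]
    change 0 ≤ ⟪Ω, ContinuousLinearMap.adjoint (π x) (π x Ω)⟫_ℂ
    rw [ContinuousLinearMap.adjoint_inner_right, inner_self_eq_norm_sq_to_K]
    exact pow_nonneg (Complex.zero_le_real.2 (norm_nonneg (π x Ω))) 2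
  · rw [hφ, map_one]
    change ⟪Ω, Ω⟫_ℂ = 1
    rw [inner_self_eq_norm_sq_to_K, hΩ]; simp

end ToeplitzCuntz

namespace ToeplitzCuntz

variable {ι : Type}

/-! ### The Hilbert space `ℰ` inside the Toeplitz-Cuntz algebra -/

/-- The vectors `basisVec i` as a Hilbert basis. -/
def basisE (ι : Type) : HilbertBasis ι ℂ (E ι) :=
  HilbertBasis.ofRepr (LinearIsometryEquiv.refl ℂ (lp (fun _ : ι => ℂ) 2))

lemma basisE_apply (i : ι) : basisE ι i = basisVec i := by
  classical
  rw [← (basisE ι).repr_symm_single]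
  unfold basisVec
  change (lp.single 2 i (1 : ℂ) : lp (fun _ : ι => ℂ) 2) = _
  congr

lemma hasSum_inner_mul_inner (f g : E ι) :
    HasSum (fun i => ⟪f, basisVec i⟫_ℂ * ⟪basisVec i, g⟫_ℂ) ⟪f, g⟫_ℂ := by
  have := (basisE ι).hasSum_inner_mul_inner f g
  simpa only [basisE_apply] using this

section Embedding

variable {A : Type*} [CStarAlgebra A] {s : ι → A}

lemma star_v_mul_sum (hs : IsToeplitzCuntzFamily s)
    (c : ι → ℂ) (t : Finset ι) (i : ι) [Decidable (i ∈ t)] :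
    star (s i) * ∑ j ∈ t, c j • s j = (if i ∈ t then c i else 0) • (1 : A) := by
  classical
  rw [Finset.mul_sum]
  have : ∀ j ∈ t, star (s i) * c j • s j = if i = j then c i • (1 : A) else 0 := by
    intro j _
    split_ifs with h
    · rw [← h, mul_smul_comm, hs.1 i]
    · rw [mul_smul_comm, hs.2 i j h, smul_zero]
  rw [Finset.sum_congr rfl this, Finset.sum_ite_eq]
  split_ifs <;> simp

lemma norm_sum_smul_v_sq [Nontrivial A] (hs : IsToeplitzCuntzFamily s) (c : ι → ℂ) (t : Finset ι) :
    ‖∑ i ∈ t, c i • s i‖ ^ 2 = ∑ i ∈ t, ‖c i‖ ^ 2 := by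
  classical
  have : star (∑ i ∈ t, c i • s i) * ∑ i ∈ t, c i • s i =
      ((∑ i ∈ t, ‖c i‖ ^ 2 : ℝ) : ℂ) • (1 : A) := by
    rw [star_sum, Finset.sum_mul]
    push_cast
    rw [Finset.sum_smul]
    refine Finset.sum_congr rfl fun i hi => ?_
    rw [star_smul, smul_mul_assoc, star_v_mul_sum hs, if_pos hi, smul_smul, Complex.star_def,
      Complex.conj_mul']
  rw [pow_two, ← CStarRing.norm_star_mul_self, this, norm_smul, norm_one, mul_one,
    Complex.norm_real, Real.norm_of_nonneg (Finset.sum_nonneg fun i _ => sq_nonneg _)]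

/-- The norm of a finite combination of the generators is the ℓ² norm of its coefficients, so the
Cauchy criterion carries over from Bessel sums. Convergence is in norm although the series need not
converge absolutely. -/
lemma summable_inner_smul_v [Nontrivial A] (hs : IsToeplitzCuntzFamily s)
    (f : E ι) : Summable fun i => ⟪basisVec i, f⟫_ℂ • s i := by
  have hsum : Summable fun i => ‖⟪basisVec i, f⟫_ℂ‖ ^ 2 := by
    have := (hasSum_inner_mul_inner f f).summable.norm
    refine this.congr fun i => ?_
    rw [norm_mul, norm_inner_symm, pow_two]
  rw [summable_iff_vanishing_norm]
  intro ε hε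
  obtain ⟨t₀, ht₀⟩ := summable_iff_vanishing_norm.1 hsum (ε ^ 2) (by positivity)
  refine ⟨t₀, fun t ht => ?_⟩
  have h1 := ht₀ t ht
  rw [← norm_sum_smul_v_sq hs, Real.norm_of_nonneg (sq_nonneg _)] at h1
  exact lt_of_pow_lt_pow_left₀ 2 hε.le h1

/-- The embedding of `ℰ` as the closed linear span of the generators. -/
def V (s : ι → A) (f : E ι) : A := ∑' i, ⟪basisVec i, f⟫_ℂ • s i

lemma hasSum_V [Nontrivial A] (hs : IsToeplitzCuntzFamily s)
    (f : E ι) : HasSum (fun i => ⟪basisVec i, f⟫_ℂ • s i) (V s f) :=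
  (summable_inner_smul_v hs f).hasSum

lemma V_sub [Nontrivial A] (hs : IsToeplitzCuntzFamily s)
    (f g : E ι) : V s (f - g) = V s f - V s g := by
  refine (hasSum_V hs _).unique ?_
  rw [show (fun i => ⟪basisVec i, f - g⟫_ℂ • s i) =
    fun i => ⟪basisVec i, f⟫_ℂ • s i - ⟪basisVec i, g⟫_ℂ • s i from funext fun i => ?_]
  · exact (hasSum_V hs f).sub (hasSum_V hs g)
  rw [inner_sub_right, sub_smul]

lemma star_v_mul_V [Nontrivial A] (hs : IsToeplitzCuntzFamily s)
    (i : ι) (f : E ι) : star (s i) * V s f = ⟪basisVec i, f⟫_ℂ • (1 : A) := by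
  refine ((hasSum_V hs f).mul_left (star (s i))).unique ?_
  convert hasSum_single i ?_ using 1
  · rw [mul_smul_comm, hs.1 i]
  · intro j hj
    rw [mul_smul_comm, hs.2 i j hj.symm, smul_zero]

lemma star_V_mul_V [Nontrivial A] (hs : IsToeplitzCuntzFamily s)
    (f g : E ι) : star (V s f) * V s g = ⟪f, g⟫_ℂ • (1 : A) := by
  refine ((hasSum_V hs f).star.mul_right (V s g)).unique ?_
  rw [show (fun i => star (⟪basisVec i, f⟫_ℂ • s i) * V s g) =
    fun i => (⟪f, basisVec i⟫_ℂ * ⟪basisVec i, g⟫_ℂ) • (1 : A) from funext fun i => ?_]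
  · exact (hasSum_inner_mul_inner f g).smul_const (1 : A)
  rw [star_smul, smul_mul_assoc, star_v_mul_V hs, smul_smul, Complex.star_def, inner_conj_symm]

lemma star_V_mul_v [Nontrivial A] (hs : IsToeplitzCuntzFamily s)
    (f : E ι) (i : ι) : star (V s f) * s i = ⟪f, basisVec i⟫_ℂ • (1 : A) := by
  rw [← star_inj, star_mul, star_star, star_v_mul_V hs, star_smul, star_one, Complex.star_def,
    inner_conj_symm]

lemma norm_V [Nontrivial A] (hs : IsToeplitzCuntzFamily s) (f : E ι) : ‖(V s f)‖ = ‖f‖ := by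
  have : ‖(V s f)‖ ^ 2 = ‖f‖ ^ 2 := by
    rw [pow_two, ← CStarRing.norm_star_mul_self, star_V_mul_V hs, norm_smul, norm_one, mul_one,
      inner_self_eq_norm_sq_to_K]
    simp
  exact (pow_left_inj₀ (norm_nonneg _) (norm_nonneg _) two_ne_zero).1 this

/-- The product `V s (e m) * V s (e (m + 1)) * ⋯ * V s (e (m + k - 1))`. -/
def W (s : ι → A) (e : ℕ → E ι) (m : ℕ) : ℕ → A
  | 0 => 1
  | k + 1 => W s e m k * V s (e (m + k))

lemma W_add (e : ℕ → E ι) (m j k : ℕ) : W s e m (j + k) = W s e m j * W s e (m + j) k := by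
  induction k with
  | zero => simp [W]
  | succ k ih => rw [← add_assoc, W, ih, W, mul_assoc, ← add_assoc]

/-- The two factors that meet in the middle collapse to a scalar, which then lets the next two meet.
-/
lemma star_W_mul_W [Nontrivial A] (hs : IsToeplitzCuntzFamily s)
    (e : ℕ → E ι) (m l k : ℕ) : star (W s e m k) * W s e l k =
    (∏ i ∈ Finset.range k, ⟪e (m + i), e (l + i)⟫_ℂ) • (1 : A) := by
  induction k with
  | zero => simp [W]
  | succ k ih =>
    rw [W, W, star_mul, mul_assoc, ← mul_assoc (star (W s e m k)), ih, smul_mul_assoc, one_mul,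
      mul_smul_comm, star_V_mul_V hs, smul_smul, Finset.prod_range_succ]

lemma star_W_mul_W_self [Nontrivial A] (hs : IsToeplitzCuntzFamily s)
    (e : ℕ → E ι) (he : ∀ k, ‖e k‖ = 1) (m k : ℕ) :
    star (W s e m k) * W s e m k = 1 := by
  rw [star_W_mul_W hs]
  simp [inner_self_eq_norm_sq_to_K, he]

lemma norm_W_le [Nontrivial A] (hs : IsToeplitzCuntzFamily s)
    (e : ℕ → E ι) (he : ∀ k, ‖e k‖ = 1) (m k : ℕ) : ‖W s e m k‖ ≤ 1 :=
  norm_le_one_of_isometry (star_W_mul_W_self hs e he m k)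

/-- The word `s_{μ 0} ⋯ s_{μ (k-1)}`. -/
def wordOf (s : ι → A) {k : ℕ} (μ : Fin k → ι) : A := (List.ofFn fun j => s (μ j)).prod

lemma wordOf_zero (μ : Fin 0 → ι) : wordOf s μ = 1 := by simp [wordOf]

lemma wordOf_succ {k : ℕ} (μ : Fin (k + 1) → ι) :
    wordOf s μ = s (μ 0) * wordOf s fun j => μ j.succ := by simp [wordOf, List.ofFn_succ]

lemma wordOf_succ' {k : ℕ} (μ : Fin (k + 1) → ι) :
    wordOf s μ = wordOf s (fun j => μ j.castSucc) * s (μ (Fin.last k)) := by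
  rw [wordOf, List.ofFn_succ', List.concat_eq_append, List.prod_append, List.prod_singleton, wordOf]

lemma star_W_mul_wordOf [Nontrivial A] (hs : IsToeplitzCuntzFamily s)
    (e : ℕ → E ι) {k : ℕ} (μ : Fin k → ι) :
    star (W s e 0 k) * wordOf s μ = (∏ j : Fin k, ⟪e j, basisVec (μ j)⟫_ℂ) • (1 : A) := by
  induction k with
  | zero => simp [W, wordOf_zero]
  | succ k ih =>
    rw [W, wordOf_succ', star_mul, mul_assoc, ← mul_assoc (star (W s e 0 k)), ih, smul_mul_assoc,
      one_mul, mul_smul_comm, star_V_mul_v hs, smul_smul, Fin.prod_univ_castSucc]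
    simp

lemma star_wordOf_mul_W [Nontrivial A] (hs : IsToeplitzCuntzFamily s)
    (e : ℕ → E ι) {k : ℕ} (μ : Fin k → ι) :
    star (wordOf s μ) * W s e 0 k = (∏ j : Fin k, ⟪basisVec (μ j), e j⟫_ℂ) • (1 : A) := by
  rw [← star_inj, star_mul, star_star, star_W_mul_wordOf hs, star_smul, star_one, Complex.star_def,
    map_prod]
  simp only [inner_conj_symm]

/-- A window of fixed length d changes one factor at a time, and each change costs at most the
distance of two vectors at distance q in the sequence. -/
lemma tendsto_norm_W_sub_W [Nontrivial A] (hs : IsToeplitzCuntzFamily s)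
    {e : ℕ → E ι} (he : ∀ k, ‖e k‖ = 1) {q : ℕ}
    (h : Tendsto (fun n => ‖e (n + q) - e n‖) atTop (𝓝 0)) (d : ℕ) :
    Tendsto (fun n => ‖W s e (n + q) d - W s e n d‖) atTop (𝓝 0) := by
  induction d with
  | zero => simp [W]
  | succ d ih =>
    have h1 : Tendsto (fun n => ‖e (n + d + q) - e (n + d)‖) atTop (𝓝 0) :=
      h.comp (tendsto_add_atTop_nat d)
    have h2 := ih.add h1
    rw [add_zero] at h2
    refine squeeze_zero (fun _ => norm_nonneg _) (fun n => ?_) h2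
    have : W s e (n + q) (d + 1) - W s e n (d + 1) =
        (W s e (n + q) d - W s e n d) * V s (e (n + q + d)) +
          W s e n d * V s (e (n + d + q) - e (n + d)) := by
      rw [V_sub hs, W, W, show n + q + d = n + d + q by ring, sub_mul, mul_sub]; abel
    rw [this]
    refine (norm_add_le _ _).trans (add_le_add ?_ ?_)
    · refine (norm_mul_le _ _).trans ?_
      rw [norm_V hs, he, mul_one]
    · refine (norm_mul_le _ _).trans ?_
      rw [norm_V hs]
      exact mul_le_of_le_one_left (norm_nonneg _) (norm_W_le hs e he _ _)

end Embedding

end ToeplitzCuntz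

namespace ToeplitzCuntz

variable {ι : Type}

/-! ### Density of the monomials -/

section Density

variable {A : Type*} [CStarAlgebra A] {s : ι → A}

/-- The linear span of the monomials `s_μ s_ν^*`. -/
def monomialSpan (s : ι → A) : Submodule ℂ A :=
  Submodule.span ℂ {x | ∃ (k l : ℕ) (μ : Fin k → ι) (ν : Fin l → ι),
    x = wordOf s μ * star (wordOf s ν)}

lemma monomial_mem {k l : ℕ} (μ : Fin k → ι) (ν : Fin l → ι) :
    wordOf s μ * star (wordOf s ν) ∈ monomialSpan s := Submodule.subset_span ⟨k, l, μ, ν, rfl⟩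

lemma one_mem_monomialSpan : (1 : A) ∈ monomialSpan s := by
  have := monomial_mem (s := s) (Fin.elim0 : Fin 0 → ι) (Fin.elim0 : Fin 0 → ι)
  rwa [wordOf_zero, star_one, mul_one] at this

/-- The elements which, with their adjoints, leave the span of the monomials invariant under left
multiplication. -/
def multipliers (s : ι → A) : StarSubalgebra ℂ A where
  carrier := {z | (∀ x ∈ monomialSpan s, z * x ∈ monomialSpan s) ∧
    ∀ x ∈ monomialSpan s, star z * x ∈ monomialSpan s}
  mul_mem' := fun {a b} ha hb => ⟨fun x hx => by
      rw [mul_assoc]; exact ha.1 _ (hb.1 x hx), fun x hx => by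
      rw [star_mul, mul_assoc]; exact hb.2 _ (ha.2 x hx)⟩
  add_mem' := fun {a b} ha hb => ⟨fun x hx => by
      rw [add_mul]; exact add_mem (ha.1 x hx) (hb.1 x hx), fun x hx => by
      rw [star_add, add_mul]; exact add_mem (ha.2 x hx) (hb.2 x hx)⟩
  algebraMap_mem' r := ⟨fun x hx => by
      rw [← Algebra.smul_def]; exact Submodule.smul_mem _ _ hx, fun x hx => by
      rw [← algebraMap_star_comm, ← Algebra.smul_def]; exact Submodule.smul_mem _ _ hx⟩
  star_mem' := fun {a} ha => ⟨ha.2, fun x hx => by rw [star_star]; exact ha.1 x hx⟩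

lemma generator_mem_multipliers (hs : IsToeplitzCuntzFamily s) (i : ι) : s i ∈ multipliers s := by
  constructor
  · intro x hx
    induction hx using Submodule.span_induction with
    | mem x hx =>
      obtain ⟨k, l, μ, ν, rfl⟩ := hx
      have : s i * (wordOf s μ * star (wordOf s ν)) =
          wordOf s (Fin.cons i μ : Fin (k + 1) → ι) * star (wordOf s ν) := by
        rw [wordOf_succ, ← mul_assoc]; simp
      rw [this]; exact monomial_mem _ _
    | zero => simp
    | add x y _ _ hx hy => rw [mul_add]; exact add_mem hx hy
    | smul c x _ hx => rw [mul_smul_comm]; exact Submodule.smul_mem _ c hx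
  · intro x hx
    induction hx using Submodule.span_induction with
    | mem x hx =>
      obtain ⟨k, l, μ, ν, rfl⟩ := hx
      cases k with
      | zero =>
        -- There is no letter to cancel, so `star (s i)` joins the adjoint word: as the last letter
        -- of ν it comes first in the adjoint.
        have : star (s i) * (wordOf s μ * star (wordOf s ν)) =
            wordOf s μ * star (wordOf s (Fin.snoc ν i : Fin (l + 1) → ι)) := by
          rw [wordOf_zero, one_mul, one_mul, wordOf_succ', star_mul]; simp
        rw [this]; exact monomial_mem _ _
      | succ k =>
        rw [wordOf_succ, ← mul_assoc, ← mul_assoc]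
        by_cases h : i = μ 0
        · rw [← h, hs.1 i, one_mul]; exact monomial_mem _ _
        · rw [hs.2 i _ h]; simp
    | zero => simp
    | add x y _ _ hx hy => rw [mul_add]; exact add_mem hx hy
    | smul c x _ hx => rw [mul_smul_comm]; exact Submodule.smul_mem _ c hx

lemma adjoin_subset_monomialSpan (hs : IsToeplitzCuntzFamily s) :
    (StarAlgebra.adjoin ℂ (Set.range s) : Set A) ⊆ monomialSpan s := by
  intro x hx
  have h : StarAlgebra.adjoin ℂ (Set.range s) ≤ multipliers s :=
    StarAlgebra.adjoin_le (by rintro _ ⟨i, rfl⟩; exact generator_mem_multipliers hs i)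
  have := (h hx).1 1 one_mem_monomialSpan
  rwa [mul_one] at this

lemma weakDual_ext (hd : Dense (monomialSpan s : Set A)) {φ ψ : WeakDual ℂ A}
    (h : ∀ (k l : ℕ) (μ : Fin k → ι) (ν : Fin l → ι),
      φ (wordOf s μ * star (wordOf s ν)) = ψ (wordOf s μ * star (wordOf s ν))) : φ = ψ := by
  have key : ∀ y ∈ monomialSpan s, φ y = ψ y := by
    intro y hy
    induction hy using Submodule.span_induction with
    | mem x hx => obtain ⟨k, l, μ, ν, rfl⟩ := hx; exact h k l μ ν
    | zero => rw [map_zero, map_zero]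
    | add x y _ _ hx hy => rw [map_add, map_add, hx, hy]
    | smul c x _ hx => rw [map_smul, map_smul, hx]
  exact ContinuousLinearMap.ext fun x => congrFun (Continuous.ext_on hd
    (WeakDual.toStrongDual φ).continuous (WeakDual.toStrongDual ψ).continuous key) x

/-! ### Averaging the gauge action -/

variable {γ : Circle → A →⋆ₐ[ℂ] A}

lemma gauge_wordOf (hγ : ∀ z i, γ z (s i) = (z : ℂ) • s i) (z : Circle) {k : ℕ} (μ : Fin k → ι) :
    γ z (wordOf s μ) = (z : ℂ) ^ k • wordOf s μ := by
  induction k with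
  | zero => simp [wordOf]
  | succ k ih => rw [wordOf_succ, map_mul, ih, hγ, smul_mul_smul_comm, pow_succ']

lemma gauge_monomial (hγ : ∀ z i, γ z (s i) = (z : ℂ) • s i) (z : Circle) {k l : ℕ}
    (μ : Fin k → ι) (ν : Fin l → ι) : γ z (wordOf s μ * star (wordOf s ν)) =
      ((z : ℂ) ^ k * star (z : ℂ) ^ l) • (wordOf s μ * star (wordOf s ν)) := by
  rw [map_mul, map_star, gauge_wordOf hγ, gauge_wordOf hγ, star_smul, smul_mul_smul_comm, star_pow]

/-- The average of the gauge action over the roots of unity of order `M`. -/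
def gaugeAvg (γ : Circle → A →⋆ₐ[ℂ] A) (M : ℕ) (x : A) : A :=
  (M : ℂ)⁻¹ • ∑ j ∈ Finset.range M, γ (Circle.exp (2 * Real.pi / M) ^ j) x

open scoped CStarAlgebra in
lemma norm_gaugeAvg_le (M : ℕ) (x : A) : ‖gaugeAvg γ M x‖ ≤ ‖x‖ := by
  rcases Nat.eq_zero_or_pos M with rfl | hM
  · simp [gaugeAvg]
  have h := norm_sum_le_of_le (Finset.range M)
    (fun j _ => NonUnitalStarAlgHom.norm_apply_le (γ (Circle.exp (2 * Real.pi / M) ^ j)) x)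
  rw [Finset.sum_const, Finset.card_range, nsmul_eq_mul] at h
  have hM' : (0 : ℝ) < M := by exact_mod_cast hM
  rw [gaugeAvg, norm_smul, norm_inv, Complex.norm_natCast, inv_mul_le_iff₀ hM']
  exact h

lemma gaugeAvg_fixed {M : ℕ} (hM : 0 < M) {x : A} (hx : ∀ z, γ z x = x) :
    gaugeAvg γ M x = x := by
  have : (M : ℂ) ≠ 0 := by exact_mod_cast hM.ne'
  rw [gaugeAvg, Finset.sum_congr rfl fun j _ => hx _, Finset.sum_const, Finset.card_range,
    ← Nat.cast_smul_eq_nsmul ℂ, inv_smul_smul₀ this]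

lemma gaugeAvg_sub (M : ℕ) (x y : A) :
    gaugeAvg γ M (x - y) = gaugeAvg γ M x - gaugeAvg γ M y := by
  simp [gaugeAvg, smul_sub]

/-- The average is a geometric sum in r = ω^(k-l), with ω a primitive root of unity of order M. Both
degrees lie below M, so r ≠ 1, and the finite average already acts like the integral over the
circle. -/
lemma gaugeAvg_monomial_of_ne (hγ : ∀ z i, γ z (s i) = (z : ℂ) • s i) {M k l : ℕ} (hk : k < M)
    (hl : l < M) (h : k ≠ l) (μ : Fin k → ι) (ν : Fin l → ι) :
    gaugeAvg γ M (wordOf s μ * star (wordOf s ν)) = 0 := by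
  have hM : M ≠ 0 := by omega
  set ω : ℂ := Complex.exp (2 * Real.pi * Complex.I / M) with hω
  have hprim : IsPrimitiveRoot ω M := Complex.isPrimitiveRoot_exp M hM
  have hc : ((Circle.exp (2 * Real.pi / M) : Circle) : ℂ) = ω := by
    rw [Circle.coe_exp, hω]; congr 1; push_cast; ring
  have hstar : star ω * ω = 1 := by
    rw [← hc, Complex.star_def, ← Complex.normSq_eq_conj_mul_self, Circle.normSq_coe]; simp
  set r : ℂ := ω ^ k * star ω ^ l with hr
  have hr1 : r ≠ 1 := by
    intro h1
    refine h (hprim.pow_inj hk hl ?_)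
    calc ω ^ k = ω ^ k * (star ω * ω) ^ l := by rw [hstar, one_pow, mul_one]
      _ = r * ω ^ l := by rw [hr, mul_pow]; ring
      _ = ω ^ l := by rw [h1, one_mul]
  have hrM : r ^ M = 1 := by
    rw [hr, mul_pow, ← pow_mul, ← pow_mul, mul_comm k, mul_comm l, pow_mul, pow_mul,
      ← star_pow, hprim.pow_eq_one]
    simp
  have hsum : ∑ j ∈ Finset.range M, r ^ j = 0 := by
    rw [geom_sum_eq hr1, hrM]; simp
  have : ∀ j, γ (Circle.exp (2 * Real.pi / M) ^ j) (wordOf s μ * star (wordOf s ν)) =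
      r ^ j • (wordOf s μ * star (wordOf s ν)) := by
    intro j
    rw [gauge_monomial hγ, Circle.coe_pow, hc, hr, mul_pow, star_pow]
    congr 1; ring
  rw [gaugeAvg, Finset.sum_congr rfl fun j _ => this j, ← Finset.sum_smul, hsum]; simp

/-- The linear span of the gauge-invariant monomials. -/
def fixedSpan (s : ι → A) : Submodule ℂ A :=
  Submodule.span ℂ {x | ∃ (k : ℕ) (μ ν : Fin k → ι), x = wordOf s μ * star (wordOf s ν)}

lemma exists_gaugeAvg_mem (hγ : ∀ z i, γ z (s i) = (z : ℂ) • s i) {y : A}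
    (hy : y ∈ monomialSpan s) : ∃ M₀ : ℕ, ∀ M, M₀ < M → gaugeAvg γ M y ∈ fixedSpan s := by
  induction hy using Submodule.span_induction with
  | mem x hx =>
    obtain ⟨k, l, μ, ν, rfl⟩ := hx
    refine ⟨k + l, fun M hM => ?_⟩
    by_cases h : k = l
    · subst h
      rw [gaugeAvg_fixed (by omega)]
      · exact Submodule.subset_span ⟨k, μ, ν, rfl⟩
      · intro z
        have hz : (z : ℂ) * star (z : ℂ) = 1 := by simp [Complex.mul_conj]
        rw [gauge_monomial hγ, ← mul_pow, hz, one_pow, one_smul]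
    · rw [gaugeAvg_monomial_of_ne hγ (by omega) (by omega) h μ ν]
      exact zero_mem _
  | zero => exact ⟨0, fun M _ => by simp [gaugeAvg]⟩
  | add x y _ _ hx hy =>
    obtain ⟨a, ha⟩ := hx
    obtain ⟨b, hb⟩ := hy
    refine ⟨max a b, fun M hM => ?_⟩
    have := add_mem (ha M (lt_of_le_of_lt (le_max_left _ _) hM))
      (hb M (lt_of_le_of_lt (le_max_right _ _) hM))
    simpa [gaugeAvg, Finset.sum_add_distrib] using this
  | smul c x _ hx =>
    obtain ⟨a, ha⟩ := hx
    refine ⟨a, fun M hM => ?_⟩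
    have := Submodule.smul_mem _ c (ha M hM)
    simpa [gaugeAvg, ← Finset.smul_sum, smul_comm c] using this

/-- The gauge-invariant elements are limits of combinations of gauge-invariant monomials. -/
lemma mem_closure_fixedSpan (hγ : ∀ z i, γ z (s i) = (z : ℂ) • s i)
    (hd : Dense (monomialSpan s : Set A)) {x : A} (hx : ∀ z, γ z x = x) :
    x ∈ closure (fixedSpan s : Set A) := by
  rw [Metric.mem_closure_iff]
  intro ε hε
  obtain ⟨y, hy, hxy⟩ := Metric.mem_closure_iff.1 (hd x) ε hε
  obtain ⟨M₀, hM⟩ := exists_gaugeAvg_mem hγ hy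
  refine ⟨_, hM (M₀ + 1) (by omega), lt_of_le_of_lt ?_ hxy⟩
  -- The averaging map is contractive and fixes x, so averaging y brings it no further from x.
  rw [← gaugeAvg_fixed (Nat.succ_pos M₀) hx, dist_eq_norm, ← gaugeAvg_sub,
    gaugeAvg_fixed (Nat.succ_pos M₀) hx, dist_eq_norm]
  exact norm_gaugeAvg_le _ _

/-- The functionals live on different algebras: the approximation takes place in `A`, and has to be
pulled back to `S`, where ρ is defined. -/
lemma apply_eq_of_mem_closure_span (S : StarSubalgebra ℂ A) (τ : WeakDual ℂ A) (ρ : WeakDual ℂ S)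
    {X : Set A} (hX : X ⊆ S) (h : ∀ (x : A) (hx : x ∈ X), τ x = ρ ⟨x, hX hx⟩) (x : S)
    (hx : (x : A) ∈ closure (Submodule.span ℂ X : Set A)) : τ x = ρ x := by
  have hle : Submodule.span ℂ X ≤ Subalgebra.toSubmodule S.toSubalgebra := Submodule.span_le.2 hX
  have hx' : x ∈ closure ((fun y : S => (y : A)) ⁻¹' (Submodule.span ℂ X)) := by
    rw [Metric.mem_closure_iff] at hx ⊢
    intro ε hε
    obtain ⟨y, hy, hxy⟩ := hx ε hε
    exact ⟨⟨y, hle hy⟩, hy, hxy⟩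
  have key : ∀ y ∈ Submodule.span ℂ X, ∃ hy : y ∈ S, τ y = ρ ⟨y, hy⟩ := by
    intro y hy
    induction hy using Submodule.span_induction with
    | mem x hx => exact ⟨hX hx, h x hx⟩
    | zero => exact ⟨zero_mem _, (map_zero τ).trans (map_zero ρ).symm⟩
    | add x y _ _ hx hy =>
      obtain ⟨hx, hx'⟩ := hx
      obtain ⟨hy, hy'⟩ := hy
      refine ⟨add_mem hx hy, (map_add τ x y).trans ?_⟩
      rw [hx', hy']
      exact (map_add ρ ⟨x, hx⟩ ⟨y, hy⟩).symm
    | smul c x _ hx =>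
      obtain ⟨hx, hx'⟩ := hx
      refine ⟨S.smul_mem hx c, (map_smul τ c x).trans ?_⟩
      rw [hx']
      exact (map_smul ρ c ⟨x, hx⟩).symm
  exact Set.EqOn.closure (f := fun x : S => τ (x : A)) (g := fun x => ρ x)
    (fun y hy => (key y hy).2) ((WeakDual.toStrongDual τ).continuous.comp continuous_subtype_val)
    (WeakDual.toStrongDual ρ).continuous hx'

end Density

/-! ### Monomials in the Toeplitz-Cuntz algebra and in its fixed-point algebra -/

section DensityTO

instance : Nontrivial (TO ι) :=
  (evalAt (fockFamily ι)).toRingHom.domain_nontrivial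

lemma dense_monomialSpan : Dense (monomialSpan (v : ι → TO ι) : Set (TO ι)) := by
  intro x
  rw [Metric.mem_closure_iff]
  intro ε hε
  have hx : (x : Ambient ι) ∈ closure
      (StarAlgebra.adjoin ℂ (Set.range (ambientGen (ι := ι))) : Set (Ambient ι)) := x.2
  obtain ⟨y, hy, hxy⟩ := Metric.mem_closure_iff.1 hx ε hε
  have hmap : StarAlgebra.adjoin ℂ (Set.range (ambientGen (ι := ι))) ≤
      (StarAlgebra.adjoin ℂ (Set.range (v : ι → TO ι))).map (toSubalgebra ι).subtype := by
    refine StarAlgebra.adjoin_le ?_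
    rintro _ ⟨i, rfl⟩
    exact ⟨v i, StarAlgebra.subset_adjoin ℂ _ ⟨i, rfl⟩, rfl⟩
  obtain ⟨z, hz, rfl⟩ := hmap hy
  exact ⟨z, adjoin_subset_monomialSpan isToeplitzCuntzFamily_v hz, hxy⟩

lemma extends_iff {τ : WeakDual ℂ (TO ι)} {ρ : WeakDual ℂ (fixedAlg ι)} :
    Extends τ ρ ↔ ∀ (k : ℕ) (μ ν : Fin k → ι),
      τ (word μ * star (word ν)) = ρ (fixedMonomial μ ν) := by
  refine ⟨fun h k μ ν => h (fixedMonomial μ ν), fun h x => ?_⟩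
  refine apply_eq_of_mem_closure_span (fixedAlg ι) τ ρ
    (by rintro _ ⟨k, μ, ν, rfl⟩; exact (fixedMonomial μ ν).2) ?_ x
    (mem_closure_fixedSpan gauge_v dense_monomialSpan x.2)
  rintro _ ⟨k, μ, ν, rfl⟩
  exact h k μ ν

end DensityTO

end ToeplitzCuntz

namespace ToeplitzCuntz

/-! ### Sequences of unit vectors -/

section Sequences

variable {H : Type*} [NormedAddCommGroup H] [InnerProductSpace ℂ H]

lemma exists_phase (z : ℂ) : ∃ u : ℂ, ‖u‖ = 1 ∧ u * z = ‖z‖ := by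
  by_cases h : z = 0
  · exact ⟨1, by simp, by simp [h]⟩
  · have hz : (‖z‖ : ℂ) ≠ 0 := by simpa using h
    refine ⟨star z / ‖z‖, ?_, ?_⟩
    · rw [norm_div, norm_star, Complex.norm_real, norm_norm, div_self (by simpa using h)]
    · rw [div_mul_eq_mul_div, Complex.star_def, Complex.conj_mul', pow_two, mul_div_assoc,
        div_self hz, mul_one]

lemma norm_sub_sq_le {a b : H} (ha : ‖a‖ = 1) (hb : ‖b‖ = 1) :
    ‖a - b‖ ^ 2 ≤ 2 * ‖1 - ⟪a, b⟫_ℂ‖ := by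
  have h1 := @norm_sub_sq ℂ _ _ _ _ a b
  have h2 := Complex.re_le_norm (1 - ⟪a, b⟫_ℂ)
  rw [Complex.sub_re, Complex.one_re] at h2
  rw [ha, hb] at h1
  simp only [RCLike.re_to_complex] at h1
  linarith

/-- A quasi-triangle inequality. -/
lemma norm_one_sub_inner_le {a b c : H} (ha : ‖a‖ = 1) (hb : ‖b‖ = 1) (hc : ‖c‖ = 1) :
    ‖1 - ⟪a, c⟫_ℂ‖ ≤ 2 * (‖1 - ⟪a, b⟫_ℂ‖ + ‖1 - ⟪b, c⟫_ℂ‖) := by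
  have hbb : ⟪b, b⟫_ℂ = 1 := by rw [inner_self_eq_norm_sq_to_K, hb]; simp
  have h : 1 - ⟪a, c⟫_ℂ = (1 - ⟪a, b⟫_ℂ) + (1 - ⟪b, c⟫_ℂ) + ⟪a - b, b - c⟫_ℂ := by
    simp only [inner_sub_left, inner_sub_right, hbb]; ring
  have h1 := norm_inner_le_norm (𝕜 := ℂ) (a - b) (b - c)
  have h2 := norm_sub_sq_le ha hb
  have h3 := norm_sub_sq_le hb hc
  have h4 := norm_add₃_le (a := 1 - ⟪a, b⟫_ℂ) (b := 1 - ⟪b, c⟫_ℂ) (c := ⟪a - b, b - c⟫_ℂ)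
  rw [← h] at h4
  nlinarith [two_mul_le_add_sq ‖a - b‖ ‖b - c‖]

/-- Phases on a and c turn the two inner products with b into their moduli, which reduces to
`norm_one_sub_inner_le`. -/
lemma one_sub_norm_inner_le {a b c : H} (ha : ‖a‖ = 1) (hb : ‖b‖ = 1) (hc : ‖c‖ = 1) :
    1 - ‖⟪a, c⟫_ℂ‖ ≤ 2 * ((1 - ‖⟪a, b⟫_ℂ‖) + (1 - ‖⟪b, c⟫_ℂ‖)) := by
  obtain ⟨u, hu, hu'⟩ := exists_phase ⟪a, b⟫_ℂ
  obtain ⟨w, hw, hw'⟩ := exists_phase ⟪b, c⟫_ℂ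
  have h := norm_one_sub_inner_le (a := star u • a) (b := b) (c := w • c)
    (by rw [norm_smul, norm_star, hu, ha, one_mul]) hb (by rw [norm_smul, hw, hc, one_mul])
  have hle : ∀ {x y : H}, ‖x‖ = 1 → ‖y‖ = 1 → ‖⟪x, y⟫_ℂ‖ ≤ 1 := fun {x y} hx hy =>
    (norm_inner_le_norm x y).trans (by rw [hx, hy, one_mul])
  have hreal : ∀ t : ℝ, t ≤ 1 → ‖(1 : ℂ) - t‖ = 1 - t := fun t ht => by
    rw [← Complex.ofReal_one, ← Complex.ofReal_sub, Complex.norm_real,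
      Real.norm_of_nonneg (sub_nonneg.2 ht)]
  rw [inner_smul_left, inner_smul_left, inner_smul_right, inner_smul_right, Complex.star_def,
    Complex.conj_conj, hu', hw', hreal _ (hle ha hb), hreal _ (hle hb hc)] at h
  refine le_trans ?_ h
  have h2 := norm_sub_norm_le (1 : ℂ) (u * (w * ⟪a, c⟫_ℂ))
  rwa [norm_one, norm_mul, norm_mul, hu, hw, one_mul, one_mul] at h2

lemma one_sub_norm_inner_nonneg {a b : H} (ha : ‖a‖ = 1) (hb : ‖b‖ = 1) :
    0 ≤ 1 - ‖⟪a, b⟫_ℂ‖ := by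
  have := norm_inner_le_norm (𝕜 := ℂ) a b
  rw [ha, hb] at this
  linarith

/-! ### Summability along the period and infinite products of inner products -/

variable {e : ℕ → H}

/-- Nonnegativity identifies 1 - |⟪e_i, e_{i+p}⟫| with |1 - ⟪e_i, e_{i+p}⟫|. The quasi-triangle
inequality for the latter then handles multiples of p; the constants that it accumulates do no harm
for fixed b. -/
lemma summable_period_mul (he : ∀ k, ‖e k‖ = 1) {p : ℕ} (hpos : ∀ i, 0 ≤ ⟪e i, e (i + p)⟫_ℂ)
    (hsum : Summable fun i => 1 - ‖⟪e i, e (i + p)⟫_ℂ‖) (b : ℕ) :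
    Summable fun i => ‖1 - ⟪e i, e (i + p * b)⟫_ℂ‖ := by
  have h1 : Summable fun i => ‖1 - ⟪e i, e (i + p)⟫_ℂ‖ := by
    refine hsum.congr fun i => ?_
    obtain ⟨t, ht, hte⟩ : ∃ t : ℝ, 0 ≤ t ∧ ⟪e i, e (i + p)⟫_ℂ = t := by
      obtain ⟨h, h'⟩ := Complex.nonneg_iff.1 (hpos i)
      exact ⟨_, h, Complex.ext rfl (by simp [← h'])⟩
    have h0 := one_sub_norm_inner_nonneg (he i) (he (i + p))
    rw [hte] at h0 ⊢
    rw [Complex.norm_real, Real.norm_of_nonneg ht] at h0 ⊢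
    rw [← Complex.ofReal_one, ← Complex.ofReal_sub, Complex.norm_real, Real.norm_of_nonneg h0]
  induction b with
  | zero => simp [inner_self_eq_norm_sq_to_K, he]
  | succ b ih =>
    have h2 : Summable fun i => ‖1 - ⟪e (i + p * b), e (i + p * b + p)⟫_ℂ‖ :=
      (summable_nat_add_iff (p * b)).2 h1
    refine Summable.of_nonneg_of_le (fun i => norm_nonneg _) (fun i => ?_)
      ((ih.add h2).mul_left 2)
    rw [show i + p * (b + 1) = i + p * b + p by ring]
    exact norm_one_sub_inner_le (he _) (he _) (he _)

lemma summable_of_period_dvd (he : ∀ k, ‖e k‖ = 1) {p : ℕ}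
    (hpos : ∀ i, 0 ≤ ⟪e i, e (i + p)⟫_ℂ)
    (hsum : Summable fun i => 1 - ‖⟪e i, e (i + p)⟫_ℂ‖) {k l : ℕ} (h : (p : ℤ) ∣ (k : ℤ) - l) :
    Summable fun i => ‖⟪e (k + i), e (l + i)⟫_ℂ - 1‖ := by
  obtain ⟨a, ha⟩ := h
  have key : ∀ m b : ℕ, Summable fun i => ‖1 - ⟪e (m + i), e (m + p * b + i)⟫_ℂ‖ := by
    intro m b
    refine ((summable_nat_add_iff m).2 (summable_period_mul he hpos hsum b)).congr fun i => ?_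
    rw [add_comm i m, add_right_comm]
  obtain ⟨b, rfl | rfl⟩ := a.eq_nat_or_neg
  · have : k = l + p * b := by zify; linarith
    subst this
    refine (key l b).congr fun i => ?_
    rw [norm_sub_rev, ← inner_conj_symm, ← Complex.norm_conj]; simp
  · have : l = k + p * b := by zify; linarith
    subst this
    exact (key k b).congr fun i => norm_sub_rev _ _

/-- The infinite product `∏ i, ⟪e (k + i), e (l + i)⟫`. -/
def prodLim (e : ℕ → H) (k l : ℕ) : ℂ := ∏' i, ⟪e (k + i), e (l + i)⟫_ℂ

lemma tendsto_prodLim {k l : ℕ} (h : Summable fun i => ‖⟪e (k + i), e (l + i)⟫_ℂ - 1‖) :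
    Tendsto (fun N => ∏ i ∈ Finset.range N, ⟪e (k + i), e (l + i)⟫_ℂ) atTop
      (𝓝 (prodLim e k l)) := by
  have := (multipliable_one_add_of_summable h).hasProd.tendsto_prod_nat
  simpa [prodLim] using this

/-- An absolutely convergent product vanishes only if some factor does, and far out all factors lie
within distance 1 of the number 1. -/
lemma eventually_prodLim_ne_zero {k l : ℕ}
    (h : Summable fun i => ‖⟪e (k + i), e (l + i)⟫_ℂ - 1‖) :
    ∀ᶠ N in atTop, prodLim e (k + N) (l + N) ≠ 0 := by
  have h0 := h.tendsto_atTop_zero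
  obtain ⟨N₀, hN₀⟩ := eventually_atTop.1 (h0.eventually (gt_mem_nhds one_pos))
  refine eventually_atTop.2 ⟨N₀, fun N hN => ?_⟩
  have h1 : Summable fun i => ‖⟪e (k + N + i), e (l + N + i)⟫_ℂ - 1‖ :=
    ((summable_nat_add_iff N).2 h).congr fun i => by
      rw [add_comm i N, add_assoc, add_assoc]
  have := tprod_one_add_ne_zero_of_summable (f := fun i => ⟪e (k + N + i), e (l + N + i)⟫_ℂ - 1)
    (fun i hi => ?_) h1
  · simpa [prodLim] using this
  · have h2 := hN₀ (N + i) (by omega)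
    rw [← add_assoc, ← add_assoc] at h2
    rw [add_sub_cancel] at hi
    rw [hi] at h2
    simp at h2

lemma prodLim_conj {k l : ℕ} (h : Summable fun i => ‖⟪e (k + i), e (l + i)⟫_ℂ - 1‖)
    (h' : Summable fun i => ‖⟪e (l + i), e (k + i)⟫_ℂ - 1‖) :
    prodLim e l k = star (prodLim e k l) := by
  refine tendsto_nhds_unique (tendsto_prodLim h') ?_
  have := (continuous_star.tendsto _).comp (tendsto_prodLim h)
  refine this.congr fun N => ?_
  simp [inner_conj_symm]

/-- Each factor has modulus t ≤ exp(-(1 - t)), and the exponents add up to -∞. -/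
lemma tendsto_prod_zero (he : ∀ k, ‖e k‖ = 1) {k l : ℕ}
    (h : ¬ Summable fun i => 1 - ‖⟪e (k + i), e (l + i)⟫_ℂ‖) :
    Tendsto (fun N => ∏ i ∈ Finset.range N, ⟪e (k + i), e (l + i)⟫_ℂ) atTop (𝓝 0) := by
  have h1 := (not_summable_iff_tendsto_nat_atTop_of_nonneg
    (fun i => one_sub_norm_inner_nonneg (he (k + i)) (he (l + i)))).1 h
  rw [tendsto_zero_iff_norm_tendsto_zero]
  refine squeeze_zero (fun _ => norm_nonneg _) (fun N => ?_)
    (Real.tendsto_exp_neg_atTop_nhds_zero.comp h1)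
  rw [norm_prod, Function.comp, ← Finset.sum_neg_distrib, Real.exp_sum]
  refine Finset.prod_le_prod (fun _ _ => norm_nonneg _) fun i _ => ?_
  have := Real.add_one_le_exp (-(1 - ‖⟪e (k + i), e (l + i)⟫_ℂ‖))
  linarith

/-- Euclid's argument: by the quasi-triangle inequality through e_i, if p and c + p are summable
distances, so is c. Minimality of p ends the descent at 0. -/
lemma dvd_of_summable (he : ∀ k, ‖e k‖ = 1) {p : ℕ}
    (hper : IsLeast {q : ℕ | 0 < q ∧ Summable fun i => 1 - ‖⟪e i, e (i + q)⟫_ℂ‖} p) (d : ℕ)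
    (hd : Summable fun i => 1 - ‖⟪e i, e (i + d)⟫_ℂ‖) : p ∣ d := by
  induction d using Nat.strong_induction_on with
  | _ d ih =>
  rcases Nat.eq_zero_or_pos d with rfl | hd0
  · exact dvd_zero _
  have hle := hper.2 ⟨hd0, hd⟩
  obtain ⟨c, rfl⟩ := Nat.exists_eq_add_of_le' hle
  have hc := ih c (by have := hper.1.1; omega) ?_
  · exact (Nat.dvd_add_self_right).2 hc
  · rw [← summable_nat_add_iff p]
    refine Summable.of_nonneg_of_le (fun i => one_sub_norm_inner_nonneg (he _) (he _))
      (fun i => ?_) ((hper.1.2.add hd).mul_left 2)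
    have := one_sub_norm_inner_le (he (i + p)) (he i) (he (i + (c + p)))
    rw [norm_inner_symm (e (i + p)) (e i)] at this
    rwa [show i + p + c = i + (c + p) by ring]

lemma not_summable_of_not_dvd (he : ∀ k, ‖e k‖ = 1) {p : ℕ}
    (hper : IsLeast {q : ℕ | 0 < q ∧ Summable fun i => 1 - ‖⟪e i, e (i + q)⟫_ℂ‖} p) {k l : ℕ}
    (h : ¬ (p : ℤ) ∣ (k : ℤ) - l) : ¬ Summable fun i => 1 - ‖⟪e (k + i), e (l + i)⟫_ℂ‖ := by
  intro hs
  have key : ∀ m d : ℕ, (Summable fun i => 1 - ‖⟪e (m + i), e (m + d + i)⟫_ℂ‖) → p ∣ d := by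
    intro m d hd
    refine dvd_of_summable he hper d ((summable_nat_add_iff m).1 (hd.congr fun i => ?_))
    rw [add_comm i m, add_right_comm]
  rcases le_total k l with hkl | hkl
  · obtain ⟨d, rfl⟩ := Nat.exists_eq_add_of_le hkl
    refine h ?_
    push_cast
    rw [sub_add_cancel_left, dvd_neg, Int.natCast_dvd_natCast]
    exact key k d hs
  · obtain ⟨d, rfl⟩ := Nat.exists_eq_add_of_le hkl
    refine h ?_
    push_cast
    rw [add_sub_cancel_left, Int.natCast_dvd_natCast]
    exact key l d (hs.congr fun i => by rw [norm_inner_symm])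

lemma tendsto_norm_sub_zero (he : ∀ k, ‖e k‖ = 1) {q : ℕ}
    (h : Summable fun i => ‖1 - ⟪e i, e (i + q)⟫_ℂ‖) :
    Tendsto (fun n => ‖e (n + q) - e n‖) atTop (𝓝 0) := by
  have h1 : Tendsto (fun n => Real.sqrt (2 * ‖1 - ⟪e n, e (n + q)⟫_ℂ‖)) atTop (𝓝 0) := by
    have := (Real.continuous_sqrt.tendsto _).comp (h.tendsto_atTop_zero.const_mul 2)
    rwa [mul_zero, Real.sqrt_zero] at this
  refine squeeze_zero (fun _ => norm_nonneg _) (fun n => ?_) h1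
  rw [norm_sub_rev]
  exact Real.le_sqrt_of_sq_le (norm_sub_sq_le (he _) (he _))

/-- The phases of unit vectors can be changed so that vectors at distance `p` have nonnegative
inner products. -/
lemma exists_rephase (e : ℕ → H) {p : ℕ} (hp : 0 < p) :
    ∃ c : ℕ → ℂ, (∀ i, ‖c i‖ = 1) ∧ ∀ i, 0 ≤ ⟪c i • e i, c (i + p) • e (i + p)⟫_ℂ := by
  choose ph hph hph' using exists_phase
  -- The phases are built separately along each residue class modulo p, starting from 1 on the first
  -- p indices; each new phase makes the inner product with the vector p places earlier equal to its
  -- modulus.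
  let c : ℕ → ℂ := fun n => Nat.strongRec (motive := fun _ => ℂ)
    (fun n ih => if h : p ≤ n then
      ih (n - p) (by omega) * ph ⟪e (n - p), e n⟫_ℂ else 1) n
  have hc : ∀ n, c n = if p ≤ n then c (n - p) * ph ⟪e (n - p), e n⟫_ℂ else 1 := by
    intro n
    simp only [c]
    rw [Nat.strongRec]
    split_ifs <;> rfl
  have hnorm : ∀ n, ‖c n‖ = 1 := by
    intro n
    induction n using Nat.strong_induction_on with
    | _ n ih =>
    rw [hc]
    split_ifs with h
    · rw [norm_mul, ih _ (by omega), hph, one_mul]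
    · exact norm_one
  refine ⟨c, hnorm, fun i => ?_⟩
  rw [hc (i + p), if_pos (by omega), Nat.add_sub_cancel, inner_smul_left, inner_smul_right,
    mul_assoc, hph', ← mul_assoc, Complex.conj_mul', hnorm]
  simp

end Sequences

end ToeplitzCuntz

namespace ToeplitzCuntz

variable {ι : Type}

/-! ### States adapted to a sequence of unit vectors -/

section Adapted

variable {A : Type*} [CStarAlgebra A] {s : ι → A} {e : ℕ → E ι} {τ : WeakDual ℂ A}

/-- The states whose restrictions to the gauge-invariant elements are the product state of the
vector states of `e`. -/
def adapted (s : ι → A) (e : ℕ → E ι) : Set (WeakDual ℂ A) :=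
  {τ | τ ∈ stateSpace A ∧ ∀ N, τ (W s e 0 N * star (W s e 0 N)) = 1}

/-- The coefficients of a functional with respect to a sequence of vectors. -/
def coeff (s : ι → A) (e : ℕ → E ι) (τ : WeakDual ℂ A) (k l : ℕ) : ℂ :=
  τ (W s e 0 k * star (W s e 0 l))

lemma coeff_conj (hτ : τ ∈ stateSpace A) (k l : ℕ) :
    coeff s e τ l k = star (coeff s e τ k l) := by
  rw [coeff, coeff, ← (isPositive_of_mem hτ).map_star, star_mul, star_star]

lemma coeff_self (hτ : τ ∈ adapted s e) (k : ℕ) : coeff s e τ k k = 1 := hτ.2 k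

lemma isCompact_adapted : IsCompact (adapted s e) := by
  have : adapted s e = stateSpace A ∩ ⋂ N, {τ | τ (W s e 0 N * star (W s e 0 N)) = 1} := by
    ext; simp [adapted]
  rw [this]
  exact isCompact_stateSpace.inter_right (isClosed_iInter fun N =>
    isClosed_singleton.preimage (WeakDual.eval_continuous _))

lemma apply_rangeProj_eq_re (hτ : τ ∈ stateSpace A) (N : ℕ) :
    τ (W s e 0 N * star (W s e 0 N)) = ((τ (W s e 0 N * star (W s e 0 N))).re : ℂ) := by
  have h := (Complex.nonneg_iff.1 (hτ.1 (star (W s e 0 N)))).2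
  rw [star_star] at h
  exact Complex.ext rfl (by simp [← h])

lemma coeff_add_eq (N d : ℕ) : coeff s e τ (N + d) N =
    τ (W s e 0 N * W s e N d * star (W s e 0 N)) := by
  rw [coeff, W_add, zero_add]

lemma norm_mul_mul_le {a b : A} (ha : ‖a‖ ≤ 1) (x : A) (hb : ‖b‖ ≤ 1) : ‖a * x * b‖ ≤ ‖x‖ := by
  refine (norm_mul_le _ _).trans ((mul_le_of_le_one_right (norm_nonneg _) hb).trans ?_)
  exact (norm_mul_le _ _).trans (mul_le_of_le_one_left (norm_nonneg _) ha)

variable [Nontrivial A]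

lemma star_W_mul_W_of_le (hs : IsToeplitzCuntzFamily s) (he : ∀ k, ‖e k‖ = 1) (k M : ℕ) :
    star (W s e 0 k) * W s e 0 (k + M) = W s e k M := by
  rw [W_add, ← mul_assoc, star_W_mul_W_self hs e he, one_mul, zero_add]

lemma star_W_mul_W_of_ge (hs : IsToeplitzCuntzFamily s) (he : ∀ k, ‖e k‖ = 1) (k M : ℕ) :
    star (W s e 0 (k + M)) * W s e 0 k = star (W s e k M) := by
  conv_rhs => rw [← star_W_mul_W_of_le hs he, star_mul, star_star]

lemma rangeProj_mul_W (hs : IsToeplitzCuntzFamily s) (he : ∀ k, ‖e k‖ = 1) (k M : ℕ) :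
    W s e 0 k * star (W s e 0 k) * W s e 0 (k + M) = W s e 0 (k + M) := by
  rw [mul_assoc, star_W_mul_W_of_le hs he, W_add, zero_add]

lemma star_rangeProj_mul_self (hs : IsToeplitzCuntzFamily s) (he : ∀ k, ‖e k‖ = 1) (k : ℕ) :
    star (W s e 0 k * star (W s e 0 k)) * (W s e 0 k * star (W s e 0 k)) =
      W s e 0 k * star (W s e 0 k) := by
  have := rangeProj_mul_W hs he k 0
  rw [add_zero] at this
  rw [star_mul, star_star, ← mul_assoc, this]

/-- The compression formula for adapted states. -/
lemma apply_of_mem_adapted (hs : IsToeplitzCuntzFamily s) (he : ∀ k, ‖e k‖ = 1)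
    (hτ : τ ∈ adapted s e) {a b : A} {α β : ℂ} {k l : ℕ}
    (ha : star (W s e 0 k) * a = α • (1 : A)) (hb : star b * W s e 0 l = β • (1 : A)) (M : ℕ) :
    τ (a * star b) = α * β * (∏ i ∈ Finset.range M, ⟪e (k + i), e (l + i)⟫_ℂ) *
      coeff s e τ (k + M) (l + M) := by
  -- The range projection of W_{k+M} is inserted on the left and that of W_{l+M} on the right, which
  -- the state does not notice.
  rw [← apply_mul_of_apply_eq_one_left hτ.1 (star_rangeProj_mul_self hs he (k + M)) (hτ.2 _),
    ← apply_mul_of_apply_eq_one hτ.1 (star_rangeProj_mul_self hs he (l + M)) (hτ.2 _)]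
  have h1 : star (W s e 0 (k + M)) * a = α • star (W s e k M) := by
    rw [W_add, star_mul, mul_assoc, ha, mul_smul_comm, mul_one, zero_add]
  have h2 : star b * W s e 0 (l + M) = β • W s e l M := by
    rw [W_add, ← mul_assoc, hb, smul_mul_assoc, one_mul, zero_add]
  have h3 : W s e 0 (k + M) * star (W s e 0 (k + M)) * (a * star b) *
      (W s e 0 (l + M) * star (W s e 0 (l + M))) =
      W s e 0 (k + M) * ((star (W s e 0 (k + M)) * a) * (star b * W s e 0 (l + M))) *
        star (W s e 0 (l + M)) := by
    simp only [mul_assoc]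
  rw [h3, h1, h2, smul_mul_smul_comm, star_W_mul_W hs, smul_smul, mul_smul_comm, mul_one,
    smul_mul_assoc, map_smul, smul_eq_mul, coeff]

lemma apply_word (hs : IsToeplitzCuntzFamily s) (he : ∀ k, ‖e k‖ = 1) (hτ : τ ∈ adapted s e)
    {k l : ℕ} (μ : Fin k → ι) (ν : Fin l → ι) : τ (wordOf s μ * star (wordOf s ν)) =
      coeff s e τ k l * (∏ j : Fin k, ⟪e j, basisVec (μ j)⟫_ℂ) *
        ∏ j : Fin l, ⟪basisVec (ν j), e j⟫_ℂ := by
  rw [apply_of_mem_adapted hs he hτ (star_W_mul_wordOf hs e μ) (star_wordOf_mul_W hs e ν) 0]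
  simp; ring

lemma coeff_eq (hs : IsToeplitzCuntzFamily s) (he : ∀ k, ‖e k‖ = 1) (hτ : τ ∈ adapted s e)
    (k l M : ℕ) : coeff s e τ k l = (∏ i ∈ Finset.range M, ⟪e (k + i), e (l + i)⟫_ℂ) *
      coeff s e τ (k + M) (l + M) := by
  rw [coeff, apply_of_mem_adapted (α := 1) (β := 1) hs he hτ _ _ M, one_mul, one_mul]
  · rw [one_smul, star_W_mul_W_self hs e he]
  · rw [one_smul, star_W_mul_W_self hs e he]

lemma norm_coeff_le (hs : IsToeplitzCuntzFamily s) (he : ∀ k, ‖e k‖ = 1) (hτ : τ ∈ stateSpace A)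
    (k l : ℕ) : ‖coeff s e τ k l‖ ≤ 1 := by
  refine (norm_apply_le_of_mem_stateSpace hτ _).trans ((norm_mul_le _ _).trans ?_)
  rw [norm_star]
  exact mul_le_one₀ (norm_W_le hs e he _ _) (norm_nonneg _) (norm_W_le hs e he _ _)

/-- In `coeff_eq` the partial products tend to 0 while the remaining coefficient stays in the unit
disc. -/
lemma coeff_eq_zero (hs : IsToeplitzCuntzFamily s) (he : ∀ k, ‖e k‖ = 1) (hτ : τ ∈ adapted s e)
    {k l : ℕ} (h : ¬ Summable fun i => 1 - ‖⟪e (k + i), e (l + i)⟫_ℂ‖) : coeff s e τ k l = 0 := by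
  have h1 := tendsto_prod_zero he h
  rw [tendsto_zero_iff_norm_tendsto_zero] at h1
  rw [← norm_le_zero_iff]
  refine ge_of_tendsto' h1 fun N => ?_
  rw [coeff_eq hs he hτ k l N, norm_mul]
  exact mul_le_of_le_one_right (norm_nonneg _) (norm_coeff_le hs he hτ.1 _ _)

lemma adapted_ext (hs : IsToeplitzCuntzFamily s) (hd : Dense (monomialSpan s : Set A))
    (he : ∀ k, ‖e k‖ = 1) (hτ : τ ∈ adapted s e) {τ' : WeakDual ℂ A} (hτ' : τ' ∈ adapted s e)
    (h : ∀ k l, coeff s e τ k l = coeff s e τ' k l) : τ = τ' :=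
  weakDual_ext hd fun k l μ ν => by rw [apply_word hs he hτ, apply_word hs he hτ', h]

/-! ### Existence of adapted pure states -/

/-- Conjugating any state by W_N gives the value 1 on the range projections of W_j for j ≤ N; a
limit over N has this value on all of them. -/
lemma exists_adapted (hs : IsToeplitzCuntzFamily s) (he : ∀ k, ‖e k‖ = 1)
    (hne : (stateSpace A).Nonempty) : (adapted s e).Nonempty := by
  obtain ⟨φ, hφ⟩ := hne
  have hφp := isPositive_of_mem hφ
  have hnorm := fun k => norm_W_le hs e he 0 k
  let g : ℕ → WeakDual ℂ A := fun N => mulFunctional φ (star (W s e 0 N)) (W s e 0 N)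
  obtain ⟨G, hG⟩ := exists_ultralimit (hyperfilter ℕ) g fun N x => by
    exact (norm_apply_le_of_mem_stateSpace hφ _).trans
      (norm_mul_mul_le ((norm_star _).trans_le (hnorm N)) x (hnorm N))
  have hg1 : ∀ N, g N 1 = 1 := fun N => by
    rw [mulFunctional_apply, mul_one, star_W_mul_W_self hs e he, hφ.2]
  refine ⟨G, mem_stateSpace_of_tendsto hG (fun N => hφp.conj _)
    (Eventually.of_forall hg1), fun j => ?_⟩
  refine tendsto_nhds_unique (hG _) (tendsto_const_nhds.congr' ?_)
  refine (eventually_ge_atTop j).filter_mono Nat.hyperfilter_le_atTop |>.mono fun N hN => ?_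
  obtain ⟨M, rfl⟩ := Nat.exists_eq_add_of_le hN
  change 1 = mulFunctional φ _ _ _
  rw [mulFunctional_apply, mul_assoc, rangeProj_mul_W hs he, star_W_mul_W_self hs e he, hφ.2]

lemma apply_rangeProj_le (hs : IsToeplitzCuntzFamily s) (he : ∀ k, ‖e k‖ = 1)
    (hτ : τ ∈ stateSpace A) (N : ℕ) : (τ (W s e 0 N * star (W s e 0 N))).re ≤ 1 := by
  have h1 := norm_coeff_le hs he hτ N N
  exact (Complex.re_le_norm _).trans h1

/-- On every state the defining values are real and at most 1, so a proper convex combination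
reaches 1 only if both ends do. -/
lemma isExtreme_adapted (hs : IsToeplitzCuntzFamily s) (he : ∀ k, ‖e k‖ = 1) :
    IsExtreme ℝ (stateSpace A) (adapted s e) := by
  refine ⟨fun τ hτ => hτ.1, fun x hx y hy τ hτ hseg => ?_⟩
  refine ⟨hx, fun N => ?_⟩
  obtain ⟨a, b, ha, hb, hab, rfl⟩ := hseg
  have h1 := congrArg Complex.re (hτ.2 N)
  have h2 : ((a • x + b • y : WeakDual ℂ A) (W s e 0 N * star (W s e 0 N))) =
    a • x (W s e 0 N * star (W s e 0 N)) + b • y (W s e 0 N * star (W s e 0 N)) := rfl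
  rw [h2, Complex.add_re, Complex.real_smul, Complex.real_smul, Complex.re_ofReal_mul,
    Complex.re_ofReal_mul, Complex.one_re] at h1
  rw [apply_rangeProj_eq_re hx]
  have h3 := apply_rangeProj_le hs he hx N
  have h4 := apply_rangeProj_le hs he hy N
  have : (x (W s e 0 N * star (W s e 0 N))).re = 1 := by nlinarith
  rw [this, Complex.ofReal_one]

/-- Krein–Milman on the compact set of adapted states; being a face, it has extreme points that are
extreme among all states. -/
lemma exists_pure_adapted (hs : IsToeplitzCuntzFamily s) (he : ∀ k, ‖e k‖ = 1)
    (hne : (stateSpace A).Nonempty) : ∃ τ ∈ adapted s e, IsPureState τ := by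
  obtain ⟨τ, hτ⟩ := (isCompact_adapted (s := s) (e := e)).extremePoints_nonempty
    (exists_adapted hs he hne)
  exact ⟨τ, hτ.1, (isExtreme_adapted hs he).extremePoints_subset_extremePoints hτ⟩

end Adapted

/-! ### The coefficients of pure adapted states -/

section Pure

variable {A : Type*} [CStarAlgebra A] [Nontrivial A] {s : ι → A} {e : ℕ → E ι}
  {τ : WeakDual ℂ A}

/-- The partial isometries which asymptotically implement the shift by the period. -/
def shiftIso (s : ι → A) (e : ℕ → E ι) (p N : ℕ) : A := W s e 0 (N + p) * star (W s e 0 N)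

lemma norm_shiftIso_le (hs : IsToeplitzCuntzFamily s) (he : ∀ k, ‖e k‖ = 1) (p N : ℕ) :
    ‖shiftIso s e p N‖ ≤ 1 := by
  refine (norm_mul_le _ _).trans ?_
  rw [norm_star]
  exact mul_le_one₀ (norm_W_le hs e he _ _) (norm_nonneg _) (norm_W_le hs e he _ _)

/-- The effect of the shift on coefficients: the difference k - l of the two degrees grows by p. -/
lemma apply_mul_shiftIso (hs : IsToeplitzCuntzFamily s) (he : ∀ k, ‖e k‖ = 1)
    (hτ : τ ∈ adapted s e) (p k l M : ℕ) :
    τ (W s e 0 k * star (W s e 0 l) * shiftIso s e p (l + M)) =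
      (∏ i ∈ Finset.range (M + p), ⟪e (k + i), e (l + i)⟫_ℂ) *
        coeff s e τ (k + (M + p)) (l + M) := by
  have h : W s e 0 k * star (W s e 0 l) * shiftIso s e p (l + M) =
      W s e 0 k * W s e l (M + p) * star (W s e 0 (l + M)) := by
    rw [shiftIso, mul_assoc, ← mul_assoc (star _), add_assoc, star_W_mul_W_of_le hs he, mul_assoc]
  rw [h, apply_of_mem_adapted (k := k + (M + p)) (l := l + M) hs he hτ
    (α := ∏ i ∈ Finset.range (M + p), ⟪e (k + i), e (l + i)⟫_ℂ) (β := 1) _ _ 0]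
  · simp
  · rw [← mul_assoc, star_W_mul_W_of_ge hs he, star_W_mul_W hs]
  · rw [star_W_mul_W_self hs e he, one_smul]

/-- With k = l + p(c+1) and N = M + l + pc one has N + p = k + M, so W_k^* meets a word that is
exactly M letters longer. After M cancellations only a window of length p(c+1) that starts at l + M
survives. -/
lemma apply_conj_shiftIso (hs : IsToeplitzCuntzFamily s) (he : ∀ k, ‖e k‖ = 1) (p l c M : ℕ) :
    star (shiftIso s e p (M + (l + p * c))) *
        (W s e 0 (l + p * (c + 1)) * star (W s e 0 l)) * shiftIso s e p (M + (l + p * c)) =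
      (∏ i ∈ Finset.range M, ⟪e (l + p * (c + 1) + i), e (l + i)⟫_ℂ) •
        (W s e 0 (M + (l + p * c)) * W s e (l + M) (p * (c + 1)) *
          star (W s e 0 (M + (l + p * c)))) := by
  have h1 : M + (l + p * c) + p = l + p * (c + 1) + M := by ring
  have h2 : M + (l + p * c) + p = l + (M + p * (c + 1)) := by ring
  have h3 : star (shiftIso s e p (M + (l + p * c))) *
        (W s e 0 (l + p * (c + 1)) * star (W s e 0 l)) * shiftIso s e p (M + (l + p * c)) =
      W s e 0 (M + (l + p * c)) * ((star (W s e 0 (M + (l + p * c) + p)) *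
        W s e 0 (l + p * (c + 1))) * (star (W s e 0 l) * W s e 0 (M + (l + p * c) + p))) *
        star (W s e 0 (M + (l + p * c))) := by
    simp only [shiftIso, star_mul, star_star, mul_assoc]
  rw [h3]
  nth_rewrite 2 [h2]
  rw [h1, star_W_mul_W_of_ge hs he, star_W_mul_W_of_le hs he, W_add e l M, ← mul_assoc (star _),
    star_W_mul_W hs, smul_mul_assoc, one_mul, mul_smul_comm, smul_mul_assoc]

variable {p : ℕ}

lemma tendsto_apply_conj_shiftIso (hs : IsToeplitzCuntzFamily s) (he : ∀ k, ‖e k‖ = 1)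
    (hτ : τ ∈ adapted s e)
    (hsum : ∀ k l : ℕ, (p : ℤ) ∣ k - l → Summable fun i => ‖⟪e (k + i), e (l + i)⟫_ℂ - 1‖)
    (hnear : ∀ b, Tendsto (fun n => ‖e (n + p * b) - e n‖) atTop (𝓝 0)) (l c : ℕ) :
    Tendsto (fun N => mulFunctional τ (star (shiftIso s e p N)) (shiftIso s e p N)
      (W s e 0 (l + p * (c + 1)) * star (W s e 0 l))) atTop
      (𝓝 (coeff s e τ (l + p * (c + 1)) l)) := by
  rw [← tendsto_add_atTop_iff_nat (l + p * c)]
  set k := l + p * (c + 1) with hk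
  set Pr : ℕ → ℂ := fun M => ∏ i ∈ Finset.range M, ⟪e (k + i), e (l + i)⟫_ℂ with hPr
  have hP : Tendsto Pr atTop (𝓝 (prodLim e k l)) :=
    tendsto_prodLim (hsum k l ⟨(c + 1 : ℕ), by rw [hk]; push_cast; ring⟩)
  -- Compared with the exact formula for the coefficient, the conjugated value has a product shorter
  -- by pc factors and a window displaced by pc. Both discrepancies vanish in the limit.
  have hd1 : Tendsto (fun M => ‖Pr M - Pr (M + p * c)‖) atTop (𝓝 0) := by
    have := (hP.sub ((tendsto_add_atTop_iff_nat (p * c)).2 hP)).norm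
    simpa using this
  have hd2 : Tendsto (fun M => ‖W s e (l + M + p * c) (p * (c + 1)) - W s e (l + M) (p * (c + 1))‖)
      atTop (𝓝 0) := by
    refine (tendsto_norm_W_sub_W hs he (hnear c) (p * (c + 1))).comp ?_
    exact tendsto_atTop_mono (fun n => Nat.le_add_left n l) tendsto_id
  have hd := hd2.add hd1
  rw [add_zero] at hd
  rw [tendsto_iff_norm_sub_tendsto_zero]
  refine squeeze_zero (fun _ => norm_nonneg _) (fun M => ?_) hd
  have hPle : ‖Pr M‖ ≤ 1 := by
    rw [hPr, norm_prod]
    exact Finset.prod_le_one (fun _ _ => norm_nonneg _) fun i _ => by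
      have := one_sub_norm_inner_nonneg (he (k + i)) (he (l + i)); linarith
  have hN : M + (l + p * c) = l + M + p * c := by ring
  have e1 : coeff s e τ k l = Pr (M + p * c) *
      τ (W s e 0 (l + M + p * c) * W s e (l + M + p * c) (p * (c + 1)) *
        star (W s e 0 (l + M + p * c))) := by
    rw [coeff_eq hs he hτ k l (M + p * c), ← coeff_add_eq]
    congr 2
    · rw [hk]; ring
    · ring
  rw [mulFunctional_apply, hk, apply_conj_shiftIso hs he, map_smul, smul_eq_mul, ← hk, e1, hN]
  set x := W s e (l + M) (p * (c + 1))
  set y := W s e (l + M + p * c) (p * (c + 1))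
  set w := W s e 0 (l + M + p * c)
  have hw : ‖w‖ ≤ 1 := norm_W_le hs e he _ _
  have hb : ∀ z : A, ‖τ (w * z * star w)‖ ≤ ‖z‖ := fun z => by
    exact (norm_apply_le_of_mem_stateSpace hτ.1 _).trans
      (norm_mul_mul_le hw z ((norm_star _).trans_le hw))
  have e2 : Pr M * τ (w * x * star w) - Pr (M + p * c) * τ (w * y * star w) =
      Pr M * τ (w * (x - y) * star w) + (Pr M - Pr (M + p * c)) * τ (w * y * star w) := by
    rw [mul_sub, sub_mul, map_sub]; ring
  change ‖Pr M * τ (w * x * star w) - Pr (M + p * c) * τ (w * y * star w)‖ ≤ _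
  rw [e2]
  refine (norm_add_le _ _).trans (add_le_add ?_ ?_)
  · rw [norm_mul, norm_sub_rev y]
    exact (mul_le_of_le_one_left (norm_nonneg _) hPle).trans (hb _)
  · rw [norm_mul]
    exact mul_le_of_le_one_right (norm_nonneg _) ((hb y).trans (norm_W_le hs e he _ _))

/-- The conjugates of an adapted state by the asymptotic shifts converge to that state. -/
lemma tendsto_conj_shiftIso (hs : IsToeplitzCuntzFamily s) (hd : Dense (monomialSpan s : Set A))
    (he : ∀ k, ‖e k‖ = 1) (hτ : τ ∈ adapted s e)
    (hsum : ∀ k l : ℕ, (p : ℤ) ∣ k - l → Summable fun i => ‖⟪e (k + i), e (l + i)⟫_ℂ - 1‖)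
    (hnsum : ∀ k l : ℕ, ¬ (p : ℤ) ∣ k - l → ¬ Summable fun i => 1 - ‖⟪e (k + i), e (l + i)⟫_ℂ‖)
    (hnear : ∀ b, Tendsto (fun n => ‖e (n + p * b) - e n‖) atTop (𝓝 0)) (x : A) :
    Tendsto (fun N => mulFunctional τ (star (shiftIso s e p N)) (shiftIso s e p N) x)
      (hyperfilter ℕ) (𝓝 (τ x)) := by
  have hn := fun N => norm_shiftIso_le hs he p N
  obtain ⟨G, hG⟩ := exists_ultralimit (hyperfilter ℕ)
    (fun N => mulFunctional τ (star (shiftIso s e p N)) (shiftIso s e p N)) fun N x => by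
    exact (norm_apply_le_of_mem_stateSpace hτ.1 _).trans
      (norm_mul_mul_le ((norm_star _).trans_le (hn N)) x (hn N))
  have huu : ∀ N, star (shiftIso s e p N) * shiftIso s e p N = W s e 0 N * star (W s e 0 N) := by
    intro N
    rw [shiftIso, star_mul, star_star, mul_assoc, ← mul_assoc (star (W s e 0 (N + p))),
      star_W_mul_W_self hs e he, one_mul]
  have hGS : G ∈ adapted s e := by
    refine ⟨mem_stateSpace_of_tendsto hG (fun N => (isPositive_of_mem hτ.1).conj _)
      (Eventually.of_forall fun N => ?_), fun j => ?_⟩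
    · rw [mulFunctional_apply, mul_one, huu, hτ.2]
    · refine tendsto_nhds_unique (hG _) (tendsto_const_nhds.congr' ?_)
      refine (eventually_ge_atTop j).filter_mono Nat.hyperfilter_le_atTop |>.mono fun N hN => ?_
      obtain ⟨M, rfl⟩ := Nat.exists_eq_add_of_le hN
      have : W s e 0 j * star (W s e 0 j) * shiftIso s e p (j + M) = shiftIso s e p (j + M) := by
        rw [shiftIso, ← mul_assoc, add_assoc, rangeProj_mul_W hs he]
      beta_reduce
      rw [mulFunctional_apply, mul_assoc, this, huu, hτ.2]
  -- Only k ≥ l has to be computed, since states are hermitian and the coefficients with p ∤ k - l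
  -- vanish for every adapted state.
  have hge : ∀ l b : ℕ, coeff s e G (l + p * b) l = coeff s e τ (l + p * b) l := by
    intro l b
    cases b with
    | zero => rw [mul_zero, add_zero, coeff_self hGS, coeff_self hτ]
    | succ c =>
      exact tendsto_nhds_unique (hG _) ((tendsto_apply_conj_shiftIso hs he hτ hsum hnear l c).mono_left
        Nat.hyperfilter_le_atTop)
  have : G = τ := by
    refine adapted_ext hs hd he hGS hτ fun k l => ?_
    by_cases hkl : (p : ℤ) ∣ k - l
    · obtain ⟨a, ha⟩ := hkl
      obtain ⟨b, rfl | rfl⟩ := a.eq_nat_or_neg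
      · have : k = l + p * b := by zify; linarith
        rw [this, hge]
      · have : l = k + p * b := by zify; linarith
        rw [this, coeff_conj hGS.1, coeff_conj hτ.1, hge]
    · rw [coeff_eq_zero hs he hGS (hnsum k l hkl), coeff_eq_zero hs he hτ (hnsum k l hkl)]
  have h := hG x
  rwa [this] at h

/-- The coefficients of a pure adapted state are given by a point of the circle. -/
theorem exists_coeff_eq_of_pure (hs : IsToeplitzCuntzFamily s)
    (hd : Dense (monomialSpan s : Set A)) (he : ∀ k, ‖e k‖ = 1) (hτ : τ ∈ adapted s e)
    (hpure : IsPureState τ)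
    (hsum : ∀ k l : ℕ, (p : ℤ) ∣ k - l → Summable fun i => ‖⟪e (k + i), e (l + i)⟫_ℂ - 1‖)
    (hnsum : ∀ k l : ℕ, ¬ (p : ℤ) ∣ k - l → ¬ Summable fun i => 1 - ‖⟪e (k + i), e (l + i)⟫_ℂ‖)
    (hnear : ∀ b, Tendsto (fun n => ‖e (n + p * b) - e n‖) atTop (𝓝 0)) :
    ∃ z : Circle, ∀ (k l : ℕ) (a : ℤ), (k : ℤ) - l = p * a →
      coeff s e τ k l = (z : ℂ) ^ a * prodLim e k l := by
  have hn := fun N => norm_shiftIso_le hs he p N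
  obtain ⟨F, hF⟩ := exists_ultralimit (hyperfilter ℕ)
    (fun N => mulFunctional τ 1 (shiftIso s e p N)) fun N x => by
    rw [mulFunctional_apply, one_mul]
    refine (norm_apply_le_of_mem_stateSpace hτ.1 _).trans ?_
    exact (norm_mul_le _ _).trans (mul_le_of_le_one_right (norm_nonneg _) (hn N))
  -- Cauchy–Schwarz bounds |τ(x^*x u_N)|² by τ(x^*x) τ(u_N^* x^*x u_N), and the last factor tends to
  -- τ(x^*x). Purity then applies.
  have hFτ : ∀ x, F x = F 1 * τ x := hpure.eq_smul_of_norm_le fun x => by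
    have h1 : ‖F (star x * x)‖ ^ 2 ≤ (τ (star x * x)).re * (τ (star x * x)).re := by
      have hc := tendsto_conj_shiftIso hs hd he hτ hsum hnsum hnear (star x * x)
      refine le_of_tendsto_of_tendsto' ((hF _).norm.pow 2)
        (((Complex.continuous_re.tendsto _).comp hc).const_mul _) fun N => ?_
      have := (isPositive_of_mem hτ.1).norm_sq_le x (x * shiftIso s e p N)
      simpa only [mulFunctional_apply, one_mul, star_mul, mul_assoc, Function.comp] using this
    rw [← pow_two] at h1
    exact (pow_le_pow_iff_left₀ (norm_nonneg _)
      (Complex.nonneg_iff.1 (hτ.1.1 x)).1 two_ne_zero).1 h1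
  have hm : ∀ b : ℕ, ∃ m : ℂ, Tendsto (fun N => coeff s e τ (N + p * b) N) (hyperfilter ℕ)
      (𝓝 m) := by
    intro b
    obtain ⟨m, -, hm⟩ := (isCompact_closedBall (0 : ℂ) 1).ultrafilter_le_nhds
      ((hyperfilter ℕ).map fun N => coeff s e τ (N + p * b) N) (by
        rw [Filter.le_principal_iff]
        refine Filter.mem_map.2 (Filter.univ_mem' fun n => ?_)
        simpa using norm_coeff_le hs he hτ.1 _ _)
    exact ⟨m, hm⟩
  choose m hm using hm
  have hdvd : ∀ l b : ℕ, (p : ℤ) ∣ ((l + p * b : ℕ) : ℤ) - l := fun l b =>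
    ⟨b, by push_cast; ring⟩
  have hev : ∀ l : ℕ, ∀ᶠ N in (hyperfilter ℕ : Filter ℕ), l ≤ N := fun l =>
    (eventually_ge_atTop l).filter_mono Nat.hyperfilter_le_atTop
  have hPr : ∀ k l c : ℕ, (p : ℤ) ∣ k - l → Tendsto
      (fun N => ∏ i ∈ Finset.range (N - l + c), ⟪e (k + i), e (l + i)⟫_ℂ) (hyperfilter ℕ)
      (𝓝 (prodLim e k l)) := fun k l c h =>
    ((tendsto_prodLim (hsum k l h)).comp ((tendsto_add_atTop_nat c).comp
      (tendsto_sub_atTop_nat l))).mono_left Nat.hyperfilter_le_atTop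
  -- Letting the cut M in `coeff_eq` tend to infinity separates the product from a number which
  -- depends only on b.
  have hcm : ∀ l b : ℕ, coeff s e τ (l + p * b) l = prodLim e (l + p * b) l * m b := by
    intro l b
    refine tendsto_nhds_unique (tendsto_const_nhds.congr' ?_)
      ((hPr (l + p * b) l 0 (hdvd l b)).mul (hm b))
    filter_upwards [hev l] with N hN
    obtain ⟨M, rfl⟩ := Nat.exists_eq_add_of_le hN
    rw [coeff_eq hs he hτ _ _ M, add_zero, Nat.add_sub_cancel_left, add_right_comm]
  -- The same limit for F, where the shift by p replaces b by b + 1.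
  have hFm : ∀ l b : ℕ, F 1 * coeff s e τ (l + p * b) l =
      prodLim e (l + p * b) l * m (b + 1) := by
    intro l b
    rw [coeff, ← hFτ]
    refine tendsto_nhds_unique (hF _) (((hPr (l + p * b) l p (hdvd l b)).mul (hm (b + 1))).congr' ?_)
    filter_upwards [hev l] with N hN
    obtain ⟨M, rfl⟩ := Nat.exists_eq_add_of_le hN
    rw [mulFunctional_apply, one_mul, apply_mul_shiftIso hs he hτ, Nat.add_sub_cancel_left]
    congr 2; ring
  have hne : ∀ b : ℕ, ∃ l, prodLim e (l + p * b) l ≠ 0 := by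
    intro b
    have := (eventually_prodLim_ne_zero (hsum _ _ (hdvd 0 b))).exists
    obtain ⟨N, hN⟩ := this
    exact ⟨N, by rwa [zero_add, zero_add, add_comm] at hN⟩
  have hm0 : m 0 = 1 := by
    refine tendsto_nhds_unique (hm 0) (tendsto_const_nhds.congr fun N => ?_)
    rw [mul_zero, add_zero, coeff_self hτ]
  have hmb : ∀ b, m b = F 1 ^ b := by
    intro b
    induction b with
    | zero => rw [hm0, pow_zero]
    | succ b ih =>
      obtain ⟨l, hl⟩ := hne b
      have h1 := hFm l b
      rw [hcm, ih] at h1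
      have : prodLim e (l + p * b) l * (m (b + 1) - F 1 ^ (b + 1)) = 0 := by
        rw [pow_succ]; linear_combination -h1
      exact sub_eq_zero.1 ((mul_eq_zero.1 this).resolve_left hl)
  have hPc : ∀ l b : ℕ, prodLim e l (l + p * b) = star (prodLim e (l + p * b) l) := fun l b =>
    prodLim_conj (hsum _ _ (hdvd l b)) (hsum _ _ (by
      rw [← neg_sub]; exact (dvd_neg).2 (hdvd l b)))
  -- On W_l W_{l+p}^*, of degree -p, the shift leads to degree 0, where the coefficient is 1.
  -- Comparison with the hermitian conjugate of the degree p case gives modulus one.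
  have hnorm : F 1 * star (F 1) = 1 := by
    obtain ⟨l, hl⟩ := hne 1
    have h1 : F 1 * coeff s e τ l (l + p * 1) = prodLim e l (l + p * 1) := by
      rw [coeff, ← hFτ]
      refine tendsto_nhds_unique (hF _) ((hPr l (l + p * 1) p (by
        rw [← neg_sub]; exact (dvd_neg).2 (hdvd l 1))).congr' ?_)
      filter_upwards [hev (l + p * 1)] with N hN
      obtain ⟨M, rfl⟩ := Nat.exists_eq_add_of_le hN
      rw [mulFunctional_apply, one_mul, apply_mul_shiftIso hs he hτ, Nat.add_sub_cancel_left,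
        show l + (M + p) = l + p * 1 + M by ring, coeff_self hτ, mul_one, mul_one]
    rw [coeff_conj hτ.1, hcm, hPc, hmb, pow_one, star_mul'] at h1
    have hl' : star (prodLim e (l + p * 1) l) ≠ 0 := star_ne_zero.2 hl
    refine mul_left_cancel₀ hl' ?_
    linear_combination h1
  have hF1 : ‖F 1‖ = 1 := by
    have h2 := congrArg norm hnorm
    rw [norm_mul, norm_star, norm_one] at h2
    nlinarith [norm_nonneg (F 1)]
  refine ⟨⟨F 1, mem_sphere_zero_iff_norm.2 hF1⟩, fun k l a ha => ?_⟩
  obtain ⟨b, rfl | rfl⟩ := a.eq_nat_or_neg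
  · have : k = l + p * b := by zify; linarith
    rw [this, hcm, hmb, zpow_natCast, mul_comm]
  · have : l = k + p * b := by zify; linarith
    rw [this, coeff_conj hτ.1, hcm, hmb, hPc, star_mul', zpow_neg, zpow_natCast, star_pow, mul_comm,
      ← inv_pow, eq_inv_of_mul_eq_one_right hnorm]

end Pure

end ToeplitzCuntz

namespace ToeplitzCuntz

variable {ι : Type}

/-! ### Gauge transformations and integrals of states -/

section Transformations

variable {A : Type*} [CStarAlgebra A] {s : ι → A} {e : ℕ → E ι} {φ τ : WeakDual ℂ A}

open scoped CStarAlgebra in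
/-- The pullback of a functional along a star homomorphism. -/
def compHom (f : A →⋆ₐ[ℂ] A) (φ : WeakDual ℂ A) : WeakDual ℂ A :=
  StrongDual.toWeakDual ((WeakDual.toStrongDual φ).comp
    ⟨f.toAlgHom.toLinearMap, map_continuous f⟩)

@[simp] lemma compHom_apply (f : A →⋆ₐ[ℂ] A) (φ : WeakDual ℂ A) (x : A) :
    compHom f φ x = φ (f x) := rfl

lemma compHom_mem_stateSpace (f : A →⋆ₐ[ℂ] A) (h : φ ∈ stateSpace A) :
    compHom f φ ∈ stateSpace A :=
  ⟨fun x => by rw [compHom_apply, map_mul, map_star]; exact h.1 _, by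
    rw [compHom_apply, map_one]; exact h.2⟩

lemma IsPureState.compHom {f g : A →⋆ₐ[ℂ] A} (hfg : ∀ x, f (g x) = x) (hgf : ∀ x, g (f x) = x)
    (h : IsPureState φ) : IsPureState (compHom f φ) := by
  refine ⟨compHom_mem_stateSpace f h.1, fun x hx y hy hseg => ?_⟩
  obtain ⟨a, b, ha, hb, hab, hsum⟩ := hseg
  have h1 : φ ∈ openSegment ℝ (ToeplitzCuntz.compHom g x) (ToeplitzCuntz.compHom g y) := by
    refine ⟨a, b, ha, hb, hab, ContinuousLinearMap.ext fun w => ?_⟩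
    have h2 := congrArg (fun ψ : WeakDual ℂ A => ψ (g w)) hsum
    change a • x (g w) + b • y (g w) = φ (f (g w)) at h2
    rw [hfg] at h2
    exact h2
  have h3 := h.2 (compHom_mem_stateSpace g hx) (compHom_mem_stateSpace g hy) h1
  refine ContinuousLinearMap.ext fun w => ?_
  change x w = φ (f w)
  rw [← h3, compHom_apply, hgf]

/-! ### The gauge action on words, coefficients and adapted states -/

section Gauge

variable [Nontrivial A] {γ : Circle → A →⋆ₐ[ℂ] A}

open scoped CStarAlgebra in
lemma gauge_V (hs : IsToeplitzCuntzFamily s) (hγ : ∀ z i, γ z (s i) = (z : ℂ) • s i) (z : Circle)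
    (f : E ι) : γ z (V s f) = (z : ℂ) • V s f := by
  refine ((hasSum_V hs f).map (γ z) (map_continuous (γ z))).unique ?_
  refine ((hasSum_V hs f).const_smul (z : ℂ)).congr_fun fun i => ?_
  rw [Function.comp, map_smul, hγ, smul_comm]

lemma gauge_W (hs : IsToeplitzCuntzFamily s) (hγ : ∀ z i, γ z (s i) = (z : ℂ) • s i) (z : Circle)
    (m k : ℕ) : γ z (W s e m k) = (z : ℂ) ^ k • W s e m k := by
  induction k with
  | zero => simp [W]
  | succ k ih => rw [W, map_mul, ih, gauge_V hs hγ, smul_mul_smul_comm, pow_succ]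

lemma gauge_W_mul_star_W (hs : IsToeplitzCuntzFamily s)
    (hγ : ∀ z i, γ z (s i) = (z : ℂ) • s i) (z : Circle) (k l : ℕ) :
    γ z (W s e 0 k * star (W s e 0 l)) =
      ((z : ℂ) ^ ((k : ℤ) - l)) • (W s e 0 k * star (W s e 0 l)) := by
  have hz : star (z : ℂ) = (z : ℂ)⁻¹ := by
    rw [Complex.star_def, ← Circle.coe_inv_eq_conj, Circle.coe_inv]
  rw [map_mul, map_star, gauge_W hs hγ, gauge_W hs hγ, star_smul, smul_mul_smul_comm, star_pow, hz,
    zpow_sub₀ (Circle.coe_ne_zero z), zpow_natCast, zpow_natCast, inv_pow, div_eq_mul_inv]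

lemma coeff_compHom (hs : IsToeplitzCuntzFamily s) (hγ : ∀ z i, γ z (s i) = (z : ℂ) • s i)
    (z : Circle) (k l : ℕ) : coeff s e (compHom (γ z) τ) k l =
      (z : ℂ) ^ ((k : ℤ) - l) * coeff s e τ k l := by
  rw [coeff, compHom_apply, gauge_W_mul_star_W hs hγ, map_smul, smul_eq_mul, coeff]

lemma compHom_mem_adapted (hs : IsToeplitzCuntzFamily s)
    (hγ : ∀ z i, γ z (s i) = (z : ℂ) • s i) (z : Circle) (h : τ ∈ adapted s e) :
    compHom (γ z) τ ∈ adapted s e :=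
  ⟨compHom_mem_stateSpace _ h.1, fun N => by
    have := coeff_compHom (e := e) (τ := τ) hs hγ z N N
    rwa [sub_self, zpow_zero, one_mul, coeff_self h] at this⟩

end Gauge

/-! ### Continuous fields of states and their integrals -/

section Fields

variable {X : Type*} [TopologicalSpace X] {t : X → WeakDual ℂ A}

/-- States are contractive, so approximating x by the span of the monomials is uniform in the
parameter. -/
lemma continuous_apply_of_monomials (hd : Dense (monomialSpan s : Set A))
    (ht : ∀ z, t z ∈ stateSpace A)
    (hc : ∀ (k l : ℕ) (μ : Fin k → ι) (ν : Fin l → ι),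
      Continuous fun z => t z (wordOf s μ * star (wordOf s ν))) (x : A) :
    Continuous fun z => t z x := by
  have key : ∀ y ∈ monomialSpan s, Continuous fun z => t z y := by
    intro y hy
    induction hy using Submodule.span_induction with
    | mem x hx => obtain ⟨k, l, μ, ν, rfl⟩ := hx; exact hc k l μ ν
    | zero => simpa only [map_zero] using continuous_const
    | add x y _ _ hx hy => simp only [map_add]; exact hx.add hy
    | smul c x _ hx => simp only [map_smul]; exact hx.const_smul c
  refine continuous_of_uniform_approx_of_continuous fun u hu => ?_
  obtain ⟨ε, hε, hεu⟩ := Metric.mem_uniformity_dist.1 hu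
  obtain ⟨y, hy, hxy⟩ := Metric.mem_closure_iff.1 (hd x) ε hε
  refine ⟨_, key y hy, fun z => hεu ?_⟩
  rw [dist_eq_norm, ← map_sub]
  refine (norm_apply_le_of_mem_stateSpace (ht z) _).trans_lt ?_
  rwa [← dist_eq_norm]

lemma exists_integral_state [CompactSpace X] [MeasurableSpace X] [BorelSpace X] (σ : Measure X)
    [IsProbabilityMeasure σ] (ht : ∀ z, t z ∈ stateSpace A)
    (hc : ∀ x, Continuous fun z => t z x) :
    ∃ τ ∈ stateSpace A, ∀ x, τ x = ∫ z, t z x ∂σ := by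
  have hint : ∀ x, Integrable (fun z => t z x) σ := fun x =>
    (hc x).integrable_of_hasCompactSupport (HasCompactSupport.of_compactSpace _)
  let L : A →ₗ[ℂ] ℂ :=
    { toFun := fun x => ∫ z, t z x ∂σ
      map_add' := fun x y => by
        simp only [map_add]; exact integral_add (hint x) (hint y)
      map_smul' := fun c x => by
        simp only [map_smul]; exact integral_smul c _ }
  have hL : ∀ x, ‖L x‖ ≤ 1 * ‖x‖ := fun x => by
    have := norm_integral_le_of_norm_le_const (μ := σ) (f := fun z => t z x) (C := ‖x‖)
      (Eventually.of_forall fun z => norm_apply_le_of_mem_stateSpace (ht z) x)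
    rwa [probReal_univ, mul_comm] at this
  refine ⟨StrongDual.toWeakDual (L.mkContinuous 1 hL), ⟨fun x => ?_, ?_⟩, fun x => rfl⟩
  · change 0 ≤ ∫ z, t z (star x * x) ∂σ
    have h : ∀ z, t z (star x * x) = ((t z (star x * x)).re : ℂ) := fun z =>
      Complex.ext rfl (by simpa using (Complex.nonneg_iff.1 ((ht z).1 x)).2.symm)
    rw [integral_congr_ae (Eventually.of_forall h), integral_complex_ofReal]
    exact Complex.zero_le_real.2
      (integral_nonneg fun z => (Complex.nonneg_iff.1 ((ht z).1 x)).1)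
  · change ∫ z, t z 1 ∂σ = 1
    rw [integral_congr_ae (Eventually.of_forall fun z => (ht z).2)]
    simp

end Fields

end Transformations

/-! ### The circle -/

section CircleLemmas

lemma exists_circle_coe_eq {x : ℂ} (hx : ‖x‖ = 1) : ∃ w : Circle, (w : ℂ) = x :=
  ⟨⟨x, mem_sphere_zero_iff_norm.2 hx⟩, rfl⟩

lemma exists_circle_pow_eq {p : ℕ} (hp : 0 < p) (u : Circle) : ∃ w : Circle, w ^ p = u := by
  obtain ⟨x, hx⟩ := IsAlgClosed.exists_pow_nat_eq (u : ℂ) hp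
  have hn : ‖x‖ = 1 := by
    have := congrArg norm hx
    rw [norm_pow, Circle.norm_coe] at this
    exact (pow_eq_one_iff_of_nonneg (norm_nonneg _) hp.ne').1 this
  obtain ⟨w, rfl⟩ := exists_circle_coe_eq hn
  exact ⟨w, Circle.ext (by rw [Circle.coe_pow]; exact hx)⟩

lemma circle_roots {p : ℕ} (hp : 0 < p) (u : Circle) :
    {w : Circle | w ^ p = u}.Finite ∧ {w : Circle | w ^ p = u}.ncard = p := by
  classical
  have hprim := Complex.isPrimitiveRoot_exp p hp.ne'
  have himg : (fun w : Circle => (w : ℂ)) '' {w : Circle | w ^ p = u} =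
      ((Polynomial.nthRoots p (u : ℂ)).toFinset : Set ℂ) := by
    ext x
    simp only [Set.mem_image, Set.mem_ofPred_eq, Finset.mem_coe, Multiset.mem_toFinset,
      Polynomial.mem_nthRoots hp]
    constructor
    · rintro ⟨w, rfl, rfl⟩; rw [Circle.coe_pow]
    · intro hx
      have hn : ‖x‖ = 1 := by
        have := congrArg norm hx
        rw [norm_pow, Circle.norm_coe] at this
        exact (pow_eq_one_iff_of_nonneg (norm_nonneg _) hp.ne').1 this
      obtain ⟨w, rfl⟩ := exists_circle_coe_eq hn
      exact ⟨w, Circle.ext (by rw [Circle.coe_pow]; exact hx), rfl⟩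
  have hinj : Function.Injective fun w : Circle => (w : ℂ) := Circle.coe_injective
  refine ⟨Set.Finite.of_finite_image (by rw [himg]; exact Finset.finite_toSet _) hinj.injOn, ?_⟩
  rw [← Set.ncard_image_of_injective _ hinj, himg, Set.ncard_coe_finset,
    Multiset.toFinset_card_of_nodup (hprim.nthRoots_nodup (Circle.coe_ne_zero u)),
    hprim.card_nthRoots, if_pos]
  obtain ⟨w, hw⟩ := exists_circle_pow_eq hp u
  exact ⟨w, by rw [← Circle.coe_pow, hw]⟩

lemma fourierTransform_pointMeasure (z : Circle) (a : ℤ) :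
    fourierTransform (pointMeasure z) a = (z : ℂ) ^ (-a) := by
  change ∫ w : Circle, (w : ℂ) ^ (-a) ∂(Measure.dirac z) = _
  rw [integral_dirac]

/-- A probability measure on the circle whose first Fourier coefficient has modulus one is a point
measure. -/
lemma eq_pointMeasure_of_fourierTransform_one (σ : ProbabilityMeasure Circle) (u : Circle)
    (h : fourierTransform σ 1 = u) : σ = pointMeasure u⁻¹ := by
  let f : Circle → ℂ := fun z => ((u * z)⁻¹ : Circle)
  have hcont : Continuous f := by fun_prop
  have hint : Integrable f (σ : Measure Circle) :=
    hcont.integrable_of_hasCompactSupport (HasCompactSupport.of_compactSpace _)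
  have hintre : Integrable (fun z => (f z).re) (σ : Measure Circle) := hint.re
  have hfeq : ∀ z, f z = (u : ℂ)⁻¹ * (z : ℂ) ^ (-1 : ℤ) := fun z => by
    change (((u * z)⁻¹ : Circle) : ℂ) = _
    rw [Circle.coe_inv, Circle.coe_mul, mul_inv, zpow_neg_one]
  have hnorm : ∀ z, ‖f z‖ = 1 := fun z => Circle.norm_coe _
  have h1 : ∫ z, f z ∂(σ : Measure Circle) = 1 := by
    simp_rw [hfeq]
    rw [integral_const_mul]
    change (u : ℂ)⁻¹ * fourierTransform σ 1 = 1
    rw [h, inv_mul_cancel₀ (Circle.coe_ne_zero u)]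
  -- The function f has modulus one and integral 1, so its real part, which is at most 1, equals 1
  -- almost everywhere; then so does f.
  have h2 : ∫ z, (1 - (f z).re) ∂(σ : Measure Circle) = 0 := by
    have h3 : ∫ z, (f z).re ∂(σ : Measure Circle) = 1 := by
      have := integral_re hint
      simp only [RCLike.re_to_complex] at this
      rw [this, h1, Complex.one_re]
    rw [integral_sub (integrable_const _) hintre, h3]; simp
  have h4 := (integral_eq_zero_iff_of_nonneg (fun z => by
    have := Complex.re_le_norm (f z)
    rw [hnorm] at this
    exact sub_nonneg.2 this) ((integrable_const _).sub hintre)).1 h2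
  have h5 : ∀ᵐ z ∂(σ : Measure Circle), z = u⁻¹ := by
    filter_upwards [h4] with z hz
    have hre : (f z).re = 1 := by
      change 1 - (f z).re = 0 at hz; linarith
    have heq : f z = 1 := by
      have h6 := Complex.sq_norm (f z)
      rw [hnorm, Complex.normSq_apply, hre] at h6
      refine Complex.ext (by rw [hre, Complex.one_re]) ?_
      rw [Complex.one_im]
      nlinarith
    have h7 : (u * z)⁻¹ = 1 := Circle.ext (by rw [Circle.coe_one]; exact heq)
    exact eq_inv_of_mul_eq_one_right (inv_eq_one.1 h7)
  refine Subtype.ext (Measure.ext fun s hs => ?_)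
  change (σ : Measure Circle) s = Measure.dirac u⁻¹ s
  rw [Measure.dirac_apply' _ hs]
  by_cases hus : u⁻¹ ∈ s
  · rw [Set.indicator_of_mem hus, Pi.one_apply]
    exact (mem_ae_iff_prob_eq_one hs).1 (h5.mono fun z hz => by rwa [hz])
  · rw [Set.indicator_of_notMem hus]
    exact measure_eq_zero_iff_ae_notMem.2 (h5.mono fun z hz => by rwa [hz])

end CircleLemmas

end ToeplitzCuntz

namespace ToeplitzCuntz

variable {ι : Type}

/-! ### The extensions given by points and by measures -/

/-- The consequences of having period `p`, for a sequence of unit vectors with suitable phases. -/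
structure IsPeriodic (e : ℕ → E ι) (p : ℕ) : Prop where
  norm_eq : ∀ k, ‖e k‖ = 1
  pos : 0 < p
  summable : ∀ k l : ℕ, (p : ℤ) ∣ k - l → Summable fun i => ‖⟪e (k + i), e (l + i)⟫_ℂ - 1‖
  not_summable : ∀ k l : ℕ, ¬ (p : ℤ) ∣ k - l →
    ¬ Summable fun i => 1 - ‖⟪e (k + i), e (l + i)⟫_ℂ‖
  tendsto : ∀ b, Tendsto (fun n => ‖e (n + p * b) - e n‖) atTop (𝓝 0)

lemma IsPeriodOfSeq.isPeriodic {e : ℕ → E ι} {p : ℕ} (h : IsPeriodOfSeq e p)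
    (he : ∀ k, ‖e k‖ = 1) (hpos : ∀ i, 0 ≤ ⟪e i, e (i + p)⟫_ℂ) : IsPeriodic e p where
  norm_eq := he
  pos := h.1.1
  summable _ _ hkl := summable_of_period_dvd he hpos h.1.2 hkl
  not_summable _ _ hkl := not_summable_of_not_dvd he h hkl
  tendsto b := tendsto_norm_sub_zero he (summable_period_mul he hpos h.1.2 b)

lemma IsPeriodic.exists_prodLim_ne_zero {e : ℕ → E ι} {p : ℕ} (hp : IsPeriodic e p) :
    ∃ l, prodLim e (l + p) l ≠ 0 := by
  obtain ⟨N, hN⟩ := (eventually_prodLim_ne_zero (hp.summable p 0 (by simp))).exists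
  exact ⟨N, by rwa [zero_add, add_comm] at hN⟩

section Points

variable {A : Type*} [CStarAlgebra A] {s : ι → A} {e : ℕ → E ι} {p : ℕ} {τ τ' : WeakDual ℂ A}
  {z w : Circle}

/-- The adapted state `τ` has the coefficients which correspond to the point `z` of the circle. -/
def IsPoint (s : ι → A) (e : ℕ → E ι) (p : ℕ) (z : Circle) (τ : WeakDual ℂ A) : Prop :=
  τ ∈ adapted s e ∧ ∀ (k l : ℕ) (a : ℤ), (k : ℤ) - l = p * a →
    coeff s e τ k l = (z : ℂ) ^ a * prodLim e k l

/-- The functional `τ` is given by the measure `σ`; compare `IsGivenBy`. -/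
def GivenBy (s : ι → A) (e : ℕ → E ι) (p : ℕ) (σ : ProbabilityMeasure Circle)
    (τ : WeakDual ℂ A) : Prop :=
  ∀ (k l : ℕ), ∃ c : ℂ,
    (∀ a : ℤ, (k : ℤ) - l = p * a → ∃ P : ℂ,
      Tendsto (fun N => ∏ i ∈ Finset.range N, ⟪e (k + i), e (l + i)⟫_ℂ) atTop (𝓝 P) ∧
        c = fourierTransform σ a * P) ∧
    (¬ (p : ℤ) ∣ (k : ℤ) - l → c = 0) ∧
    ∀ (μ : Fin k → ι) (ν : Fin l → ι),
      τ (wordOf s μ * star (wordOf s ν)) =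
        c * (∏ j : Fin k, ⟪e j, basisVec (μ j)⟫_ℂ) * ∏ j : Fin l, ⟪basisVec (ν j), e j⟫_ℂ

lemma GivenBy.unique (hd : Dense (monomialSpan s : Set A)) {σ : ProbabilityMeasure Circle}
    (h : GivenBy s e p σ τ) (h' : GivenBy s e p σ τ') : τ = τ' := by
  refine weakDual_ext hd fun k l μ ν => ?_
  obtain ⟨c, hc, hc0, hcw⟩ := h k l
  obtain ⟨c', hc', hc0', hcw'⟩ := h' k l
  have : c = c' := by
    by_cases hkl : (p : ℤ) ∣ (k : ℤ) - l
    · obtain ⟨a, ha⟩ := hkl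
      obtain ⟨P, hP, rfl⟩ := hc a ha
      obtain ⟨P', hP', rfl⟩ := hc' a ha
      rw [tendsto_nhds_unique hP hP']
    · rw [hc0 hkl, hc0' hkl]
  rw [hcw, hcw', this]

/-- A generating Toeplitz-Cuntz family with its gauge action. -/
structure IsGaugeSystem (s : ι → A) (γ : Circle → A →⋆ₐ[ℂ] A) : Prop where
  family : IsToeplitzCuntzFamily s
  dense : Dense (monomialSpan s : Set A)
  gauge : ∀ z i, γ z (s i) = (z : ℂ) • s i

variable [Nontrivial A]

lemma IsPoint.ext (hs : IsToeplitzCuntzFamily s) (hd : Dense (monomialSpan s : Set A))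
    (hp : IsPeriodic e p) (h : IsPoint s e p z τ) (h' : IsPoint s e p z τ') : τ = τ' := by
  refine adapted_ext hs hd hp.norm_eq h.1 h'.1 fun k l => ?_
  by_cases hkl : (p : ℤ) ∣ (k : ℤ) - l
  · obtain ⟨a, ha⟩ := hkl
    rw [h.2 k l a ha, h'.2 k l a ha]
  · rw [coeff_eq_zero hs hp.norm_eq h.1 (hp.not_summable k l hkl),
      coeff_eq_zero hs hp.norm_eq h'.1 (hp.not_summable k l hkl)]

omit [Nontrivial A] in
lemma IsPoint.unique (hp : IsPeriodic e p) (h : IsPoint s e p z τ) (h' : IsPoint s e p w τ) :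
    z = w := by
  obtain ⟨l, hl⟩ := hp.exists_prodLim_ne_zero
  have h1 := h.2 (l + p) l 1 (by push_cast; ring)
  rw [h'.2 (l + p) l 1 (by push_cast; ring), zpow_one, zpow_one] at h1
  exact Circle.ext (mul_right_cancel₀ hl h1).symm

lemma exists_isPoint_of_pure (hs : IsToeplitzCuntzFamily s)
    (hd : Dense (monomialSpan s : Set A)) (hp : IsPeriodic e p) (hτ : τ ∈ adapted s e)
    (hpure : IsPureState τ) : ∃ z : Circle, IsPoint s e p z τ := by
  obtain ⟨z, hz⟩ := exists_coeff_eq_of_pure hs hd hp.norm_eq hτ hpure hp.summable hp.not_summable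
    hp.tendsto
  exact ⟨z, hτ, hz⟩

lemma givenBy_of_coeff (hs : IsToeplitzCuntzFamily s) (hp : IsPeriodic e p)
    {σ : ProbabilityMeasure Circle} (hτ : τ ∈ adapted s e)
    (h : ∀ (k l : ℕ) (a : ℤ), (k : ℤ) - l = p * a →
      coeff s e τ k l = fourierTransform σ a * prodLim e k l) : GivenBy s e p σ τ :=
  fun k l => ⟨coeff s e τ k l,
    fun a ha => ⟨prodLim e k l, tendsto_prodLim (hp.summable k l ⟨a, ha⟩), h k l a ha⟩,
    fun hkl => coeff_eq_zero hs hp.norm_eq hτ (hp.not_summable k l hkl),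
    fun μ ν => apply_word hs hp.norm_eq hτ μ ν⟩

/-- The inverse appears because the Fourier transform of δ_z at a is z^(-a), while the parameter of
a point state enters as its a-th power. -/
lemma IsPoint.givenBy (hs : IsToeplitzCuntzFamily s) (hp : IsPeriodic e p)
    (h : IsPoint s e p z⁻¹ τ) : GivenBy s e p (pointMeasure z) τ :=
  givenBy_of_coeff hs hp h.1 fun k l a ha => by
    rw [h.2 k l a ha, fourierTransform_pointMeasure, Circle.coe_inv, inv_zpow']

/-! ### The gauge orbit of a pure point state, and integrals of point states -/

variable {γ : Circle → A →⋆ₐ[ℂ] A}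

lemma gauge_W_mul_star_W_self (hs : IsToeplitzCuntzFamily s)
    (hγ : ∀ z i, γ z (s i) = (z : ℂ) • s i) (z : Circle) (N : ℕ) :
    γ z (W s e 0 N * star (W s e 0 N)) = W s e 0 N * star (W s e 0 N) := by
  rw [gauge_W_mul_star_W hs hγ, sub_self, zpow_zero, one_smul]

omit [Nontrivial A] in
open scoped CStarAlgebra in
lemma gauge_gauge_inv (hd : Dense (monomialSpan s : Set A))
    (hγ : ∀ z i, γ z (s i) = (z : ℂ) • s i) (z : Circle) (x : A) : γ z (γ z⁻¹ x) = x := by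
  refine congrFun (Continuous.ext_on (f := fun x => γ z (γ z⁻¹ x)) (g := fun x => x) hd
    ((map_continuous (γ z)).comp (map_continuous (γ z⁻¹))) continuous_id fun y hy => ?_) x
  induction hy using Submodule.span_induction with
  | mem x hx =>
    obtain ⟨k, l, μ, ν, rfl⟩ := hx
    beta_reduce
    have hz : (z : ℂ) ^ k * star (z : ℂ) ^ l * ((z : ℂ) ^ k * star (z : ℂ) ^ l)⁻¹ = 1 :=
      mul_inv_cancel₀ (mul_ne_zero (pow_ne_zero _ (Circle.coe_ne_zero z))
        (pow_ne_zero _ (star_ne_zero.2 (Circle.coe_ne_zero z))))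
    rw [gauge_monomial hγ, map_smul, gauge_monomial hγ, smul_smul, mul_comm, Circle.coe_inv,
      star_inv₀, inv_pow, inv_pow, ← mul_inv, hz, one_smul]
  | zero => simp only [map_zero]
  | add x y _ _ hx hy =>
    beta_reduce at hx hy ⊢
    rw [map_add, map_add, hx, hy]
  | smul c x _ hx =>
    beta_reduce at hx ⊢
    rw [map_smul, map_smul, hx]

omit [Nontrivial A] in
lemma IsPureState.compHom_gauge (hd : Dense (monomialSpan s : Set A))
    (hγ : ∀ z i, γ z (s i) = (z : ℂ) • s i) (h : IsPureState τ) (z : Circle) :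
    IsPureState (ToeplitzCuntz.compHom (γ z) τ) :=
  h.compHom (g := γ z⁻¹) (gauge_gauge_inv hd hγ z) fun x => by
    have := gauge_gauge_inv hd hγ z⁻¹ x
    rwa [inv_inv] at this

/-- A coefficient of degree k - l = pa is multiplied by w^(pa) = (w^p)^a; this p-th power is the
source of the p-to-1 action. -/
lemma IsPoint.compHom (hs : IsToeplitzCuntzFamily s) (hγ : ∀ z i, γ z (s i) = (z : ℂ) • s i)
    (h : IsPoint s e p z τ) (w : Circle) : IsPoint s e p (w ^ p * z) (compHom (γ w) τ) := by
  refine ⟨compHom_mem_adapted hs hγ w h.1, fun k l a ha => ?_⟩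
  rw [coeff_compHom hs hγ, h.2 k l a ha, ha, Circle.coe_mul, Circle.coe_pow, mul_zpow, zpow_mul,
    zpow_natCast, mul_assoc]

/-- One pure adapted state exists at some u, and the gauge automorphism of a p-th root of z/u moves
it to z. -/
lemma exists_pure_isPoint (hs : IsToeplitzCuntzFamily s) (hd : Dense (monomialSpan s : Set A))
    (hne : (stateSpace A).Nonempty) (hγ : ∀ z i, γ z (s i) = (z : ℂ) • s i)
    (hp : IsPeriodic e p) (z : Circle) :
    ∃ τ, IsPoint s e p z τ ∧ IsPureState τ := by
  obtain ⟨τ, hτ, hpure⟩ := exists_pure_adapted hs hp.norm_eq hne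
  obtain ⟨u, hu⟩ := exists_isPoint_of_pure hs hd hp hτ hpure
  obtain ⟨w, hw⟩ := exists_circle_pow_eq hp.pos (z * u⁻¹)
  refine ⟨ToeplitzCuntz.compHom (γ w) τ, ?_, hpure.compHom_gauge hd hγ w⟩
  have := hu.compHom hs hγ w
  rwa [hw, inv_mul_cancel_right] at this

/-- A choice of the states which correspond to the points of the circle. -/
lemma exists_pointFamily (hs : IsToeplitzCuntzFamily s) (hd : Dense (monomialSpan s : Set A))
    (hne : (stateSpace A).Nonempty) (hγ : ∀ z i, γ z (s i) = (z : ℂ) • s i)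
    (hp : IsPeriodic e p) :
    ∃ t : Circle → WeakDual ℂ A, ∀ z, IsPoint s e p z⁻¹ (t z) ∧ IsPureState (t z) :=
  ⟨_, fun z => (exists_pure_isPoint hs hd hne hγ hp z⁻¹).choose_spec⟩

lemma continuous_isPoint (hs : IsToeplitzCuntzFamily s) (hd : Dense (monomialSpan s : Set A))
    (hp : IsPeriodic e p) {t : Circle → WeakDual ℂ A} (ht : ∀ z, IsPoint s e p z⁻¹ (t z)) (x : A) :
    Continuous fun z => t z x := by
  refine continuous_apply_of_monomials hd (fun z => (ht z).1.1) (fun k l μ ν => ?_) x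
  simp_rw [fun z => apply_word hs hp.norm_eq (ht z).1 μ ν]
  refine (Continuous.mul ?_ continuous_const).mul continuous_const
  by_cases hkl : (p : ℤ) ∣ (k : ℤ) - l
  · obtain ⟨a, ha⟩ := hkl
    simp_rw [fun z => (ht z).2 k l a ha]
    refine Continuous.mul ?_ continuous_const
    simp_rw [← Circle.coe_zpow]
    exact continuous_induced_dom.comp (continuous_inv.zpow a)
  · simp_rw [fun z => coeff_eq_zero hs hp.norm_eq (ht z).1 (hp.not_summable k l hkl)]
    exact continuous_const

/-- The state is the integral over σ of the point states; integrating z^(-a) produces the Fourier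
coefficient. -/
lemma exists_adapted_coeff (hs : IsToeplitzCuntzFamily s) (hd : Dense (monomialSpan s : Set A))
    (hp : IsPeriodic e p) {t : Circle → WeakDual ℂ A} (ht : ∀ z, IsPoint s e p z⁻¹ (t z))
    (σ : ProbabilityMeasure Circle) : ∃ τ ∈ adapted s e, ∀ (k l : ℕ) (a : ℤ),
      (k : ℤ) - l = p * a → coeff s e τ k l = fourierTransform σ a * prodLim e k l := by
  obtain ⟨τ, hτ, hint⟩ := exists_integral_state (σ : Measure Circle) (fun z => (ht z).1.1)
    (continuous_isPoint hs hd hp ht)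
  refine ⟨τ, ⟨hτ, fun N => ?_⟩, fun k l a ha => ?_⟩
  · rw [hint, integral_congr_ae (Eventually.of_forall fun z => (ht z).1.2 N)]
    simp
  · rw [coeff, hint]
    have : ∀ z, t z (W s e 0 k * star (W s e 0 l)) = (z : ℂ) ^ (-a) * prodLim e k l := fun z => by
      have := (ht z).2 k l a ha
      rwa [Circle.coe_inv, inv_zpow'] at this
    rw [integral_congr_ae (Eventually.of_forall this), integral_mul_const]
    rfl

/-- A pure state is a point state, so comparing coefficients of degree p at an index where the
infinite product is nonzero shows that the first Fourier coefficient of σ lies on the circle. -/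
lemma exists_eq_pointMeasure (hs : IsToeplitzCuntzFamily s) (hd : Dense (monomialSpan s : Set A))
    (hp : IsPeriodic e p) {σ : ProbabilityMeasure Circle} (hτ : τ ∈ adapted s e)
    (hpure : IsPureState τ) (h : ∀ (k l : ℕ) (a : ℤ), (k : ℤ) - l = p * a →
      coeff s e τ k l = fourierTransform σ a * prodLim e k l) :
    ∃ z : Circle, σ = pointMeasure z := by
  obtain ⟨u, hu⟩ := exists_isPoint_of_pure hs hd hp hτ hpure
  obtain ⟨l, hl⟩ := hp.exists_prodLim_ne_zero
  have h1 := hu.2 (l + p) l 1 (by push_cast; ring)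
  rw [h (l + p) l 1 (by push_cast; ring), zpow_one] at h1
  exact ⟨u⁻¹, eq_pointMeasure_of_fourierTransform_one σ u (mul_right_cancel₀ hl h1)⟩

end Points

/-! ### Vector product states -/

lemma vectorState_matrixUnit (f : E ι) (i j : ι) :
    vectorState f (matrixUnit i j) = ⟪f, basisVec i⟫_ℂ * ⟪basisVec j, f⟫_ℂ := by
  change ⟪f, InnerProductSpace.rankOne ℂ (basisVec i) (basisVec j) f⟫_ℂ = _
  rw [InnerProductSpace.rankOne_apply, inner_smul_right, mul_comm]

lemma ext_basisVec {f g : E ι} (h : ∀ i, ⟪basisVec i, f⟫_ℂ = ⟪basisVec i, g⟫_ℂ) : f = g := by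
  refine ext_inner_left ℂ fun x => ?_
  refine (hasSum_inner_mul_inner x f).unique ?_
  simpa only [h] using hasSum_inner_mul_inner x g

lemma exists_inner_basisVec_ne_zero {f : E ι} (hf : ‖f‖ = 1) : ∃ i, ⟪basisVec i, f⟫_ℂ ≠ 0 := by
  by_contra! h
  have : f = 0 := ext_basisVec fun i => by rw [h, inner_zero_right]
  rw [this, norm_zero] at hf
  exact zero_ne_one hf

variable {ρ : WeakDual ℂ (fixedAlg ι)} {e e' : ℕ → E ι} {p : ℕ}

lemma IsVectorProduct.apply (h : IsVectorProduct ρ e) {m : ℕ} (μ ν : Fin m → ι) :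
    ρ (fixedMonomial μ ν) =
      ∏ k : Fin m, (⟪e k, basisVec (μ k)⟫_ℂ * ⟪basisVec (ν k), e k⟫_ℂ) := by
  rw [h.2]
  exact Finset.prod_congr rfl fun k _ => vectorState_matrixUnit _ _ _

lemma IsVectorProduct.smul (h : IsVectorProduct ρ e) {c : ℕ → ℂ} (hc : ∀ k, ‖c k‖ = 1) :
    IsVectorProduct ρ fun k => c k • e k := by
  refine ⟨fun k => by rw [norm_smul, hc, h.1, one_mul], fun m μ ν => ?_⟩
  rw [h.apply]
  refine Finset.prod_congr rfl fun k _ => ?_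
  rw [vectorState_matrixUnit, inner_smul_left, inner_smul_right]
  have := Complex.conj_mul' (c k)
  rw [hc] at this
  linear_combination -(⟪e k, basisVec (μ k)⟫_ℂ * ⟪basisVec (ν k), e k⟫_ℂ) * this +
    (⟪e k, basisVec (μ k)⟫_ℂ * ⟪basisVec (ν k), e k⟫_ℂ) * (by push_cast; ring :
      (1 : ℂ) - ((1 : ℝ) : ℂ) ^ 2 = 0)

/-- The vectors which define a product state are unique up to phases. -/
lemma IsVectorProduct.exists_eq_smul (h : IsVectorProduct ρ e) (h' : IsVectorProduct ρ e')
    (m : ℕ) : ∃ c : ℂ, ‖c‖ = 1 ∧ e' m = c • e m := by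
  -- Indices at which the vectors have nonzero components make the value on the first m positions
  -- nonzero, so that it can be cancelled to isolate position m.
  choose i hi using fun k => exists_inner_basisVec_ne_zero (h.1 k)
  have hi' : ∀ k, ⟪e k, basisVec (i k)⟫_ℂ ≠ 0 := fun k => by
    rw [← inner_conj_symm]; exact (map_ne_zero _).2 (hi k)
  have h1 := h.apply (fun k : Fin m => i k) fun k : Fin m => i k
  rw [h'.apply] at h1
  have hne : ∏ k : Fin m, (⟪e k, basisVec (i k)⟫_ℂ * ⟪basisVec (i k), e k⟫_ℂ) ≠ 0 :=
    Finset.prod_ne_zero_iff.2 fun k _ => mul_ne_zero (hi' k) (hi k)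
  have key : ∀ a b, ⟪e' m, basisVec a⟫_ℂ * ⟪basisVec b, e' m⟫_ℂ =
      ⟪e m, basisVec a⟫_ℂ * ⟪basisVec b, e m⟫_ℂ := by
    intro a b
    have h2 := h.apply (Fin.snoc (fun k : Fin m => i k) a : Fin (m + 1) → ι)
      (Fin.snoc (fun k : Fin m => i k) b : Fin (m + 1) → ι)
    rw [h'.apply, Fin.prod_univ_castSucc, Fin.prod_univ_castSucc] at h2
    simp only [Fin.snoc_castSucc, Fin.snoc_last, Fin.val_castSucc, Fin.val_last] at h2
    rw [h1] at h2
    exact mul_left_cancel₀ hne h2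
  have hi0' : ⟪e' m, basisVec (i m)⟫_ℂ ≠ 0 := by
    intro h0
    have := key (i m) (i m)
    rw [h0, zero_mul] at this
    exact mul_ne_zero (hi' m) (hi m) this.symm
  have heq : e' m = (⟪e m, basisVec (i m)⟫_ℂ / ⟪e' m, basisVec (i m)⟫_ℂ) • e m := by
    refine ext_basisVec fun b => ?_
    rw [inner_smul_right, div_mul_eq_mul_div, eq_div_iff hi0', ← key, mul_comm]
  refine ⟨_, ?_, heq⟩
  have := congrArg norm heq
  rwa [norm_smul, h.1, h'.1, mul_one, eq_comm] at this

lemma IsVectorProduct.isPeriodOfSeq (h : IsVectorProduct ρ e) (h' : IsVectorProduct ρ e')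
    (hper : IsPeriodOfSeq e p) : IsPeriodOfSeq e' p := by
  choose c hc hce using fun m => h.exists_eq_smul h' m
  have : ∀ i j, ‖⟪e' i, e' j⟫_ℂ‖ = ‖⟪e i, e j⟫_ℂ‖ := fun i j => by
    rw [hce i, hce j, inner_smul_left, inner_smul_right, norm_mul, norm_mul, RCLike.norm_conj, hc,
      hc, one_mul, one_mul]
  simpa only [IsPeriodOfSeq, this] using hper

/-! ### States of the Toeplitz-Cuntz algebra -/

lemma isGaugeSystem_TO (ι : Type) : IsGaugeSystem (v : ι → TO ι) gauge :=
  ⟨isToeplitzCuntzFamily_v, dense_monomialSpan, gauge_v⟩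

lemma gaugeAct_eq_compHom (z : Circle) (τ : WeakDual ℂ (TO ι)) :
    gaugeAct z τ = compHom (gauge z) τ := rfl

lemma stateSpace_TO_nonempty : (stateSpace (TO ι)).Nonempty :=
  stateSpace_nonempty (H := Fock ι) (evalAt (fockFamily ι))

lemma IsVectorProduct.extends_of_mem_adapted (h : IsVectorProduct ρ e) {τ : WeakDual ℂ (TO ι)}
    (hτ : τ ∈ adapted v e) : Extends τ ρ := by
  refine extends_iff.2 fun k μ ν => ?_
  rw [h.apply, Finset.prod_mul_distrib]
  refine (apply_word (isGaugeSystem_TO ι).family h.1 hτ μ ν).trans ?_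
  rw [coeff_self hτ, one_mul]

/-- The range projection of W_N is gauge invariant, so its value is fixed by ρ. Comparison with some
adapted state, which also extends ρ, shows that this value is 1. -/
lemma IsVectorProduct.mem_adapted_of_extends (h : IsVectorProduct ρ e) {τ : WeakDual ℂ (TO ι)}
    (hτ : τ ∈ stateSpace (TO ι)) (hext : Extends τ ρ) : τ ∈ adapted v e := by
  obtain ⟨φ, hφ⟩ := exists_adapted (isGaugeSystem_TO ι).family h.1 (stateSpace_TO_nonempty (ι := ι))
  refine ⟨hτ, fun N => ?_⟩
  let q : fixedAlg ι := ⟨W v e 0 N * star (W v e 0 N), 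
    fun z => gauge_W_mul_star_W_self (isGaugeSystem_TO ι).family (isGaugeSystem_TO ι).gauge z N⟩
  exact (hext q).trans ((h.extends_of_mem_adapted hφ q).symm.trans (hφ.2 N))

lemma IsVectorProduct.mem_pureExtensions_iff (h : IsVectorProduct ρ e) {τ : WeakDual ℂ (TO ι)} :
    τ ∈ pureExtensions ρ ↔ IsPureState τ ∧ τ ∈ adapted v e :=
  ⟨fun hτ => ⟨hτ.1, h.mem_adapted_of_extends hτ.1.1 hτ.2⟩,
    fun hτ => ⟨hτ.1, h.extends_of_mem_adapted hτ.2⟩⟩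

lemma IsVectorProduct.gaugeAct_mem (h : IsVectorProduct ρ e) {τ : WeakDual ℂ (TO ι)}
    (hτ : τ ∈ pureExtensions ρ) (z : Circle) : gaugeAct z τ ∈ pureExtensions ρ := by
  rw [h.mem_pureExtensions_iff] at hτ ⊢
  rw [gaugeAct_eq_compHom]
  exact ⟨hτ.1.compHom_gauge (isGaugeSystem_TO ι).dense (isGaugeSystem_TO ι).gauge z,
    compHom_mem_adapted (isGaugeSystem_TO ι).family (isGaugeSystem_TO ι).gauge z hτ.2⟩

lemma IsVectorProduct.transitive (h : IsVectorProduct ρ e) (hp : IsPeriodic e p)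
    {τ τ' : WeakDual ℂ (TO ι)} (hτ : τ ∈ pureExtensions ρ) (hτ' : τ' ∈ pureExtensions ρ) :
    {z : Circle | gaugeAct z τ = τ'}.Finite ∧ {z : Circle | gaugeAct z τ = τ'}.ncard = p := by
  rw [h.mem_pureExtensions_iff] at hτ hτ'
  obtain ⟨u, hu⟩ := exists_isPoint_of_pure
    (isGaugeSystem_TO ι).family (isGaugeSystem_TO ι).dense hp hτ.2 hτ.1
  obtain ⟨w, hw⟩ := exists_isPoint_of_pure
    (isGaugeSystem_TO ι).family (isGaugeSystem_TO ι).dense hp hτ'.2 hτ'.1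
  -- If τ and τ' sit at u and w, then τ is moved to z^p u, and a point state is determined by its
  -- parameter: the solutions are the p-th roots of w/u.
  have : {z : Circle | gaugeAct z τ = τ'} = {z : Circle | z ^ p = w * u⁻¹} := by
    ext z
    have hz : IsPoint v e p (z ^ p * u) (gaugeAct z τ) :=
      hu.compHom (isGaugeSystem_TO ι).family (isGaugeSystem_TO ι).gauge z
    change gaugeAct z τ = τ' ↔ z ^ p = w * u⁻¹
    rw [eq_mul_inv_iff_mul_eq]
    constructor
    · intro hzτ
      rw [hzτ] at hz
      exact hz.unique hp hw
    · intro hzw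
      rw [hzw] at hz
      exact hz.ext (isGaugeSystem_TO ι).family (isGaugeSystem_TO ι).dense hp hw
  rw [this]
  exact circle_roots hp.pos _

lemma IsVectorProduct.homeomorph (h : IsVectorProduct ρ e) (hp : IsPeriodic e p) :
    ∃ h : Circle ≃ₜ pureExtensions ρ, ∀ z : Circle, IsGivenBy e p (pointMeasure z) (h z) := by
  obtain ⟨t, ht⟩ := exists_pointFamily (isGaugeSystem_TO ι).family (isGaugeSystem_TO ι).dense
    (stateSpace_TO_nonempty (ι := ι)) (isGaugeSystem_TO ι).gauge hp
  let f : Circle → pureExtensions ρ := fun z =>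
    ⟨t z, h.mem_pureExtensions_iff.2 ⟨(ht z).2, (ht z).1.1⟩⟩
  have hf : Continuous f := by
    refine Continuous.subtype_mk ?_ _
    exact WeakDual.continuous_of_continuous_eval
      (continuous_isPoint
          (isGaugeSystem_TO ι).family (isGaugeSystem_TO ι).dense hp fun z => (ht z).1)
  have hbij : Function.Bijective f := by
    refine ⟨fun z w hzw => ?_, fun τ => ?_⟩
    · have hzw' : t z = t w := congrArg Subtype.val hzw
      have hz := (ht z).1
      rw [hzw'] at hz
      exact inv_injective (hz.unique hp (ht w).1)
    · obtain ⟨hτ, hτ'⟩ := h.mem_pureExtensions_iff.1 τ.2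
      obtain ⟨u, hu⟩ := exists_isPoint_of_pure
          (isGaugeSystem_TO ι).family (isGaugeSystem_TO ι).dense hp hτ' hτ
      refine ⟨u⁻¹, Subtype.ext ?_⟩
      have := (ht u⁻¹).1
      rw [inv_inv] at this
      exact this.ext (isGaugeSystem_TO ι).family (isGaugeSystem_TO ι).dense hp hu
  have hc : Continuous (Equiv.ofBijective f hbij) := hf
  exact ⟨hc.homeoOfEquivCompactToT2, fun z => (ht z).1.givenBy (isGaugeSystem_TO ι).family hp⟩

lemma IsPeriodic.existsUnique_isGivenBy (hp : IsPeriodic e p) (σ : ProbabilityMeasure Circle) :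
    ∃! τ : WeakDual ℂ (TO ι), IsGivenBy e p σ τ := by
  obtain ⟨t, ht⟩ := exists_pointFamily (isGaugeSystem_TO ι).family (isGaugeSystem_TO ι).dense
    (stateSpace_TO_nonempty (ι := ι)) (isGaugeSystem_TO ι).gauge hp
  obtain ⟨τ, hτ, hcoeff⟩ := exists_adapted_coeff
    (isGaugeSystem_TO ι).family (isGaugeSystem_TO ι).dense hp
    (fun z => (ht z).1) σ
  have hg : GivenBy v e p σ τ := givenBy_of_coeff (isGaugeSystem_TO ι).family hp hτ hcoeff
  exact ⟨τ, hg, fun τ' (hτ' : GivenBy v e p σ τ') => hτ'.unique (isGaugeSystem_TO ι).dense hg⟩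

lemma IsVectorProduct.of_isGivenBy (h : IsVectorProduct ρ e) (hp : IsPeriodic e p)
    {σ : ProbabilityMeasure Circle} {τ : WeakDual ℂ (TO ι)} (hg : IsGivenBy e p σ τ) :
    τ ∈ stateSpace (TO ι) ∧ Extends τ ρ ∧
      (IsPureState τ ↔ ∃ z : Circle, σ = pointMeasure z) := by
  have hg' : GivenBy v e p σ τ := hg
  obtain ⟨t, ht⟩ := exists_pointFamily (isGaugeSystem_TO ι).family (isGaugeSystem_TO ι).dense
    (stateSpace_TO_nonempty (ι := ι)) (isGaugeSystem_TO ι).gauge hp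
  obtain ⟨τ', hτ', hcoeff⟩ := exists_adapted_coeff
    (isGaugeSystem_TO ι).family (isGaugeSystem_TO ι).dense hp
    (fun z => (ht z).1) σ
  have heq : τ = τ' := hg'.unique (isGaugeSystem_TO ι).dense
    (givenBy_of_coeff (isGaugeSystem_TO ι).family hp hτ' hcoeff)
  subst heq
  refine ⟨hτ'.1, h.extends_of_mem_adapted hτ', fun hpure => ?_, ?_⟩
  · exact exists_eq_pointMeasure
      (isGaugeSystem_TO ι).family (isGaugeSystem_TO ι).dense hp hτ' hpure hcoeff
  · rintro ⟨z, rfl⟩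
    have : τ = t z := hg'.unique (isGaugeSystem_TO ι).dense
      ((ht z).1.givenBy (isGaugeSystem_TO ι).family hp)
    rw [this]
    exact (ht z).2

end ToeplitzCuntz

theorem mainTheorem6 (ι : Type) [Countable ι] [Nonempty ι]
    (ρ : WeakDual ℂ (ToeplitzCuntz.fixedAlg ι)) (p : ℕ)
    (hpure : ToeplitzCuntz.IsPureState ρ)
    (hess : ToeplitzCuntz.IsEssential ρ)
    (hprod : ToeplitzCuntz.IsProductState ρ)
    (hper : ToeplitzCuntz.HasPeriod ρ p) :
    -- the gauge group acts on the pure extensions of `ρ`, `p`-to-`1` transitively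
    (∀ z : Circle, ∀ τ ∈ ToeplitzCuntz.pureExtensions ρ,
      ToeplitzCuntz.gaugeAct z τ ∈ ToeplitzCuntz.pureExtensions ρ) ∧
    (∀ τ ∈ ToeplitzCuntz.pureExtensions ρ, ∀ τ' ∈ ToeplitzCuntz.pureExtensions ρ,
      {z : Circle | ToeplitzCuntz.gaugeAct z τ = τ'}.Finite ∧
      {z : Circle | ToeplitzCuntz.gaugeAct z τ = τ'}.ncard = p) ∧
    -- the vectors that define `ρ` can be rephased so that `⟨e_i, e_{i+p}⟩ ≥ 0` for all `i`
    (∃ e : ℕ → ToeplitzCuntz.E ι, ToeplitzCuntz.IsVectorProduct ρ e ∧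
      ∀ i, 0 ≤ ⟪e i, e (i + p)⟫_ℂ) ∧
    -- and for every such choice the pure extensions are given exactly by the point measures
    (∀ e : ℕ → ToeplitzCuntz.E ι, ToeplitzCuntz.IsVectorProduct ρ e →
      (∀ i, 0 ≤ ⟪e i, e (i + p)⟫_ℂ) →
      (∀ σ : ProbabilityMeasure Circle, ∃! τ : WeakDual ℂ (ToeplitzCuntz.TO ι),
        ToeplitzCuntz.IsGivenBy e p σ τ) ∧
      (∀ (σ : ProbabilityMeasure Circle) (τ : WeakDual ℂ (ToeplitzCuntz.TO ι)),
        ToeplitzCuntz.IsGivenBy e p σ τ →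
          τ ∈ ToeplitzCuntz.stateSpace (ToeplitzCuntz.TO ι) ∧ ToeplitzCuntz.Extends τ ρ ∧
          (ToeplitzCuntz.IsPureState τ ↔ ∃ z : Circle, σ = ToeplitzCuntz.pointMeasure z)) ∧
      -- the pure extensions, with the weak-* topology, form precisely a circle
      ∃ h : Circle ≃ₜ ToeplitzCuntz.pureExtensions ρ,
        ∀ z : Circle, ToeplitzCuntz.IsGivenBy e p (ToeplitzCuntz.pointMeasure z) (h z)) := by
  obtain ⟨e₀, hv₀, hper₀⟩ := hper
  -- The period is given for one sequence of vectors only. Any other sequence for ρ differs from it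
  -- by phases, which do not enter the moduli in the definition of the period.
  have key : ∀ e : ℕ → ToeplitzCuntz.E ι, ToeplitzCuntz.IsVectorProduct ρ e →
      (∀ i, 0 ≤ ⟪e i, e (i + p)⟫_ℂ) → ToeplitzCuntz.IsPeriodic e p := fun e he hpos =>
    (hv₀.isPeriodOfSeq he hper₀).isPeriodic he.1 hpos
  obtain ⟨c, hc, hpos⟩ := ToeplitzCuntz.exists_rephase e₀ hper₀.1.1
  have hv₁ := hv₀.smul hc
  have hp₁ := key _ hv₁ hpos
  exact ⟨fun z τ hτ => hv₁.gaugeAct_mem hτ z, fun τ hτ τ' hτ' => hv₁.transitive hp₁ hτ hτ',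
    ⟨_, hv₁, hpos⟩, fun e he hpos =>
    ⟨(key e he hpos).existsUnique_isGivenBy,
      fun σ τ hg => he.of_isGivenBy (key e he hpos) hg, he.homeomorph (key e he hpos)⟩⟩
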